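/- Consider finitely many nodes $i=1,\dots,I$ with unknown states $x_i\in\mathbb{R}^{n_i}$ ($n_i\ge 1$), self measurements $z_i=C_ix_i+v_i$, and, for every edge $\{i,j\}$ of a simple undirected graph (arbitrary, possibly cyclic), a joint measurement $z_{i,j}=z_{j,i}=C_{i,j}x_i+C_{j,i}x_j+v_{i,j}$ of dimension at least $1$, with positive definite noise covariances $R_i$ and $R_{i,j}=R_{j,i}$. Let $\mathcal N_i$ be the set of neighbors of node $i$. The matrices $C_i$, $C_{i,j}$, $R_i$, $R_{i,j}$ and the measured values $z_i$, $z_{i,j}$ are given (the statement holds for every realization of the measurements). Assume $C_i^TR_i^{-1}C_i>0$ for all $i$. The distributed WLS algorithm starts from $\alpha_{j\to i}(0)=0$, $Q_{j\to i}(0)=0$ and computes, for $N=1,2,\dots$, \[ \alpha_i(N)=C_i^TR_i^{-1}z_i+\sum_{j\in\mathcal N_i}\alpha_{j\to i}(N-1),\quad Q_i(N)=C_i^TR_i^{-1}C_i+\sum_{j\in\mathcal N_i}Q_{j\to i}(N-1),\quad \hat x_i(N)=Q_i(N)^{-1}\alpha_i(N), \] and, for $j\in\mathcal N_i$, \[ \alpha_{i\to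 j}(N)=C_{j,i}^TR_{i\to j}(N)^{-1}z_{i\to j}(N),\qquad Q_{i\to j}(N)=C_{j,i}^TR_{i\to j}(N)^{-1}C_{j,i}, \] \[ z_{i\to j}(N)=z_{i,j}-C_{i,j}\bigl(Q_i(N)-Q_{j\to i}(N-1)\bigr)^{-1}\bigl(\alpha_i(N)-\alpha_{j\to i}(N-1)\bigr), \] \[ R_{i\to j}(N)=R_{i,j}+C_{i,j}\bigl(Q_i(N)-Q_{j\to i}(N-1)\bigr)^{-1}C_{i,j}^T . \] Write $\|\cdot\|$ for the Euclidean norm of vectors and the spectral norm of matrices, $\sigma_{\min}$ for the smallest singular value; below, $i,j$ in $C_{i,j}$, $R_{i,j}$, $z_{i,j}$ run over pairs of neighbors. Put $\bar u=\max_i|\mathcal N_i|-1$, $\bar n=\max_i\dim x_i$, $\bar m=\max\{\max_i\dim z_i,\max_{i,j}\dim z_{i,j}\}$, \[ \lambda=\frac{\alpha_1}{\alpha_1+\beta_1}\,\frac{\alpha_2}{\alpha_2+\beta_2},\quad \alpha_1=\bar u\max_{i,j}\|C_{i,j}^TR_{i,j}^{-1}C_{i,j}\|,\quad \beta_1=\min_i\sigma_{\min}(C_i^TR_i^{-1}C_i),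 \] \[ \alpha_2=\max_{i,j}\|C_{i,j}(C_i^TR_i^{-1}C_i)^{-1}C_{i,j}^T\|,\quad \beta_2=\min_{i,j}\sigma_{\min}(R_{i,j}), \] \[ \bar r=\max_{i,j}\{\|R_i\|,\|R_{i,j}\|\},\quad \underline r=\min_{i,j}\{\sigma_{\min}(R_i),\sigma_{\min}(R_{i,j})\}, \] \[ \bar\varepsilon=\max_{i,j}\sqrt{\|C_i\|^2+4\bar u\|C_{i,j}\|^2},\quad \underline\varepsilon=\min_i\sigma_{\min}(C_i),\quad \bar q=\bar\varepsilon^2\underline r^{-1},\quad \underline q=\underline\varepsilon^2\bar r^{-1},\quad \iota=\frac{\sqrt{\bar q}-\sqrt{\underline q}}{\sqrt{\bar q}+\sqrt{\underline q}}, \] \[ c=\frac{\bar q-\underline q}{2\bar q\,\underline q\,\iota},\quad \check\zeta=2+\log_{1/\sqrt\lambda}(\bar q/\underline q),\quad \bar\xi=\max_j\log\Bigl\|I+\Bigl(\sum_{k\in\mathcal N_j}C_{j,k}^TR_{j,k}^{-1}C_{j,k}\Bigr)(C_j^TR_j^{-1}C_j)^{-1}\Bigr\|, \] \[ \bar z=\max_{i,j}\{\|z_i\|_\infty,\|z_{i,j}\|_\infty\},\quad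 \check\psi=e^{\bar\xi\sqrt{\bar n(\bar u+1)}}-1,\quad \check\eta=\frac{\bar\varepsilon\,\bar z\sqrt{8\bar m(\bar u+1)}}{\underline r}, \] \[ \check\chi=\frac{\check\psi\,\check\eta}{(\bar q-\underline q)\lambda}+\frac{2\check\eta c}{1-\iota},\qquad \check\kappa=\max\{\bar u\sqrt\lambda,\ \sqrt{\bar u}\,\iota^{1/\check\zeta}\}. \] Assume that some node has at least two neighbors and that not all the matrices $C_{i,j}$ vanish (equivalently $\lambda>0$, so that these constants are defined). If $\check\kappa<1$, then, for every node, labeled $1$, and all integers $N\ge 1$, \[ \|\hat x_1(N+1)-\hat x_1(N)\|\le\check\chi\,\check\kappa^{N}. \] Consequently the sequence $\hat x_1(N)$ converges exponentially: it has a limit $\hat x_1(\infty)$, and $\|\hat x_1(N)-\hat x_1(\infty)\|\le\frac{\check\chi}{1-\check\kappa}\check\kappa^{N}$ for all $N\ge1$. -/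

import Mathlib

noncomputable section

namespace DistributedWLS

open scoped Matrix Matrix.Norms.L2Operator

/-- A network of sensing nodes, indexed by `V`, with self measurements `z i = C i * x i + v i`
and, for every edge `e = s(i, j)` of the communication graph, a joint measurement
`zJ e = CJ e i * x i + CJ e j * x j + vJ e`. The covariances of the noises `v i` and `vJ e` are
`R i` and `RJ e`. In the notation `C_{i,j}`, `R_{i,j}`, `z_{i,j}` with
`R_{i,j} = R_{j,i}` and `z_{i,j} = z_{j,i}`, one has `C_{i,j} = CJ s(i, j) i`,
`C_{j,i} = CJ s(i, j) j`, `R_{i,j} = RJ s(i, j)` and `z_{i,j} = zJ s(i, j)`.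
The measurement vectors are arbitrary, that is, one works with an arbitrary realization of the
noises. Data attached to an `e` that is not an edge, or to an `e` and a node that is not an
endpoint of `e`, is never used. -/
structure Network (V : Type*) where
  /-- The communication graph; `i` and `j` are adjacent iff they have a joint measurement. -/
  graph : SimpleGraph V
  /-- Dimension of the state of a node. -/
  n : V → ℕ
  /-- Dimension of the self measurement of a node. -/
  m : V → ℕ
  /-- Dimension of the joint measurement of an edge. -/
  mJ : Sym2 V → ℕ
  /-- Self measurement matrices. -/
  C : ∀ i, Matrix (Fin (m i)) (Fin (n i)) ℝ
  /-- Covariances of the self measurement noises. -/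
  R : ∀ i, Matrix (Fin (m i)) (Fin (m i)) ℝ
  /-- Self measurements. -/
  z : ∀ i, Fin (m i) → ℝ
  /-- Joint measurement matrices. -/
  CJ : ∀ e i, Matrix (Fin (mJ e)) (Fin (n i)) ℝ
  /-- Covariances of the joint measurement noises. -/
  RJ : ∀ e, Matrix (Fin (mJ e)) (Fin (mJ e)) ℝ
  /-- Joint measurements. -/
  zJ : ∀ e, Fin (mJ e) → ℝ
  n_pos : ∀ i, 0 < n i
  mJ_pos : ∀ e ∈ graph.edgeSet, 0 < mJ e
  R_posDef : ∀ i, (R i).PosDef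
  RJ_posDef : ∀ e ∈ graph.edgeSet, (RJ e).PosDef

/-- The smallest singular value of `A`, as the minimum of `‖A x‖₂` over the unit sphere. (It is
only used for matrices with at least as many rows as columns, and at least one column.) -/
def sigmaMin {p q : ℕ} (A : Matrix (Fin p) (Fin q) ℝ) : ℝ :=
  ⨅ x : Metric.sphere (0 : EuclideanSpace ℝ (Fin q)) 1, ‖Matrix.toEuclideanLin A x‖

namespace Network

variable {V : Type*} [Fintype V] (W : Network V)

open scoped Classical in
/-- The set `N_i` of the neighbors of node `i`. -/
def nbrs (i : V) : Finset V := Finset.univ.filter (fun j => W.graph.Adj i j)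

/-! ### The algorithm -/

/-- `C_iᵀ R_i⁻¹ C_i`. -/
def selfInfo (i : V) : Matrix (Fin (W.n i)) (Fin (W.n i)) ℝ :=
  (W.C i)ᵀ * (W.R i)⁻¹ * W.C i

/-- `Q_i = C_iᵀ R_i⁻¹ C_i + ∑_{j ∈ N_i} Q_{j → i}`, where `P j i` is the message `Q_{j → i}`. -/
def gatherMat (P : ∀ _ i : V, Matrix (Fin (W.n i)) (Fin (W.n i)) ℝ) (i : V) :
    Matrix (Fin (W.n i)) (Fin (W.n i)) ℝ :=
  W.selfInfo i + ∑ j ∈ W.nbrs i, P j i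

/-- `α_i = C_iᵀ R_i⁻¹ z_i + ∑_{j ∈ N_i} α_{j → i}`, where `a j i` is the message `α_{j → i}`. -/
def gatherVec (a : ∀ _ i : V, Fin (W.n i) → ℝ) (i : V) : Fin (W.n i) → ℝ :=
  ((W.C i)ᵀ * (W.R i)⁻¹) *ᵥ W.z i + ∑ j ∈ W.nbrs i, a j i

/-- `(Q_i - Q_{j → i})⁻¹`, given the messages `P`. -/
def cavityCov (P : ∀ _ i : V, Matrix (Fin (W.n i)) (Fin (W.n i)) ℝ) (i j : V) :
    Matrix (Fin (W.n i)) (Fin (W.n i)) ℝ :=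
  (W.gatherMat P i - P j i)⁻¹

/-- `R_{i → j} = R_{i,j} + C_{i,j} (Q_i - Q_{j → i})⁻¹ C_{i,j}ᵀ`, given the messages `P`. -/
def msgCov (P : ∀ _ i : V, Matrix (Fin (W.n i)) (Fin (W.n i)) ℝ) (i j : V) :
    Matrix (Fin (W.mJ s(i, j))) (Fin (W.mJ s(i, j))) ℝ :=
  W.RJ s(i, j) + W.CJ s(i, j) i * W.cavityCov P i j * (W.CJ s(i, j) i)ᵀ

/-- `z_{i → j} = z_{i,j} - C_{i,j} (Q_i - Q_{j → i})⁻¹ (α_i - α_{j → i})`, given the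
messages `P` and `a`. -/
def msgMeas (P : ∀ _ i : V, Matrix (Fin (W.n i)) (Fin (W.n i)) ℝ)
    (a : ∀ _ i : V, Fin (W.n i) → ℝ) (i j : V) : Fin (W.mJ s(i, j)) → ℝ :=
  W.zJ s(i, j) - (W.CJ s(i, j) i * W.cavityCov P i j) *ᵥ (W.gatherVec a i - a j i)

/-- `matMsg N i j` is the matrix `Q_{i → j}(N)` that node `i` sends to its neighbor `j`. -/
def matMsg : ℕ → ∀ _ j : V, Matrix (Fin (W.n j)) (Fin (W.n j)) ℝ
  | 0 => fun _ _ => 0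
  | N + 1 => fun i j =>
      (W.CJ s(i, j) j)ᵀ * (W.msgCov (matMsg N) i j)⁻¹ * W.CJ s(i, j) j

/-- `vecMsg N i j` is the vector `α_{i → j}(N)` that node `i` sends to its neighbor `j`. -/
def vecMsg : ℕ → ∀ _ j : V, Fin (W.n j) → ℝ
  | 0 => fun _ _ => 0
  | N + 1 => fun i j =>
      ((W.CJ s(i, j) j)ᵀ * (W.msgCov (W.matMsg N) i j)⁻¹) *ᵥ
        W.msgMeas (W.matMsg N) (vecMsg N) i j

/-- The information matrix `Q_i(N)`, for `N ≥ 1`. -/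
def infoMat (N : ℕ) (i : V) : Matrix (Fin (W.n i)) (Fin (W.n i)) ℝ :=
  W.gatherMat (W.matMsg (N - 1)) i

/-- The information vector `α_i(N)`, for `N ≥ 1`. -/
def infoVec (N : ℕ) (i : V) : Fin (W.n i) → ℝ :=
  W.gatherVec (W.vecMsg (N - 1)) i

/-- The estimate `x̂_i(N) = Q_i(N)⁻¹ α_i(N)`, for `N ≥ 1`. The iterations of the algorithm are
numbered `1, 2, 3, …`, so that there is no estimate for `N = 0`. -/
def estimate (N : ℕ) (i : V) : EuclideanSpace ℝ (Fin (W.n i)) :=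
  WithLp.toLp 2 ((W.infoMat N i)⁻¹ *ᵥ W.infoVec N i)

/-! ### The constants

Matrix norms are spectral norms, the norm of a measurement vector `z i` or `zJ e` is its maximum
norm. Suprema and infima over nodes, edges and ordered pairs of neighbors (`Dart`) are over
finite sets. -/

/-- `ū = max_i |N_i| - 1`. -/
def uBar : ℝ := ((Finset.univ.sup fun i => (W.nbrs i).card : ℕ) : ℝ) - 1

/-- `n̄ = max_i dim x_i`. -/
def nBar : ℕ := Finset.univ.sup W.n

open scoped Classical in
/-- `m̄ = max {max_i dim z_i, max_{i,j} dim z_{i,j}}`. -/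
def mBar : ℕ :=
  max (Finset.univ.sup W.m) ((Finset.univ.filter (fun e => e ∈ W.graph.edgeSet)).sup W.mJ)

/-- `α₁ = ū max_{i,j} ‖C_{i,j}ᵀ R_{i,j}⁻¹ C_{i,j}‖`. -/
def alpha₁ : ℝ :=
  W.uBar * ⨆ d : W.graph.Dart, ‖(W.CJ d.edge d.fst)ᵀ * (W.RJ d.edge)⁻¹ * W.CJ d.edge d.fst‖

/-- `β₁ = min_i σ_min(C_iᵀ R_i⁻¹ C_i)`. -/
def beta₁ : ℝ := ⨅ i, sigmaMin (W.selfInfo i)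

/-- `α₂ = max_{i,j} ‖C_{i,j} (C_iᵀ R_i⁻¹ C_i)⁻¹ C_{i,j}ᵀ‖`. -/
def alpha₂ : ℝ :=
  ⨆ d : W.graph.Dart,
    ‖W.CJ d.edge d.fst * (W.selfInfo d.fst)⁻¹ * (W.CJ d.edge d.fst)ᵀ‖

/-- `β₂ = min_{i,j} σ_min(R_{i,j})`. -/
def beta₂ : ℝ := ⨅ e : W.graph.edgeSet, sigmaMin (W.RJ e)

/-- `λ = α₁ / (α₁ + β₁) * α₂ / (α₂ + β₂)`. -/
def lam : ℝ := W.alpha₁ / (W.alpha₁ + W.beta₁) * (W.alpha₂ / (W.alpha₂ + W.beta₂))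

/-- `r̄ = max {‖R_i‖, ‖R_{i,j}‖}`. -/
def rUpper : ℝ := max (⨆ i, ‖W.R i‖) (⨆ e : W.graph.edgeSet, ‖W.RJ e‖)

/-- `r̲ = min {σ_min(R_i), σ_min(R_{i,j})}`. -/
def rLower : ℝ := min (⨅ i, sigmaMin (W.R i)) (⨅ e : W.graph.edgeSet, sigmaMin (W.RJ e))

/-- `ε̄ = max_{i,j} √(‖C_i‖² + 4 ū ‖C_{i,j}‖²)`. -/
def epsUpper : ℝ :=
  ⨆ d : W.graph.Dart, √(‖W.C d.fst‖ ^ 2 + 4 * W.uBar * ‖W.CJ d.edge d.fst‖ ^ 2)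

/-- `ε̲ = min_i σ_min(C_i)`. -/
def epsLower : ℝ := ⨅ i, sigmaMin (W.C i)

/-- `q̄ = ε̄² / r̲`. -/
def qUpper : ℝ := W.epsUpper ^ 2 * W.rLower⁻¹

/-- `q̲ = ε̲² / r̄`. -/
def qLower : ℝ := W.epsLower ^ 2 * W.rUpper⁻¹

/-- `ι = (√q̄ - √q̲) / (√q̄ + √q̲)`. -/
def iota : ℝ := (√W.qUpper - √W.qLower) / (√W.qUpper + √W.qLower)

/-- `c = (q̄ - q̲) / (2 q̄ q̲ ι)`. -/
def cConst : ℝ := (W.qUpper - W.qLower) / (2 * W.qUpper * W.qLower * W.iota)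

/-- `ζ = 2 + log_{1/√λ} (q̄ / q̲)`. -/
def zeta : ℝ := 2 + Real.logb (1 / √W.lam) (W.qUpper / W.qLower)

/-- `ξ̄ = max_j log ‖I + (∑_{k ∈ N_j} C_{j,k}ᵀ R_{j,k}⁻¹ C_{j,k}) (C_jᵀ R_j⁻¹ C_j)⁻¹‖`. -/
def xiBar : ℝ :=
  ⨆ j, Real.log ‖1 + (∑ k ∈ W.nbrs j,
    (W.CJ s(j, k) j)ᵀ * (W.RJ s(j, k))⁻¹ * W.CJ s(j, k) j) * (W.selfInfo j)⁻¹‖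

/-- `z̄ = max {‖z_i‖_∞, ‖z_{i,j}‖_∞}`. -/
def zBar : ℝ := max (⨆ i, ‖W.z i‖) (⨆ e : W.graph.edgeSet, ‖W.zJ e‖)

/-- `ψ = exp(ξ̄ √(n̄ (ū + 1))) - 1`. -/
def psi : ℝ := Real.exp (W.xiBar * √(W.nBar * (W.uBar + 1))) - 1

/-- `η = ε̄ z̄ √(8 m̄ (ū + 1)) / r̲`. -/
def eta : ℝ := W.epsUpper * W.zBar * √(8 * W.mBar * (W.uBar + 1)) / W.rLower

/-- `χ = ψ η / ((q̄ - q̲) λ) + 2 η c / (1 - ι)`. -/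
def chi : ℝ :=
  W.psi * W.eta / ((W.qUpper - W.qLower) * W.lam) + 2 * W.eta * W.cConst / (1 - W.iota)

/-- `κ = max {ū √λ, √ū ι^(1/ζ)}`. -/
def kappa : ℝ := max (W.uBar * √W.lam) (√W.uBar * W.iota ^ (1 / W.zeta))

end Network

end DistributedWLS

end

/-! Unrolling the messages turns the estimate of a node at iteration `N` into the root component of
a weighted least squares solution on the computation tree of depth `N - 1`, formed by
non-backtracking walks. The root has at most `ū + 1` children and any other node at most `ū`; cycles
of the graph play no role. `RJ_mulVec_resid`, `selfInfo_mulVec_child` and `selfInfo_mulVec_root` are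
the normal equations of this tree problem.

One more iteration adds one layer of leaves. The difference of the two solutions solves the
homogeneous equations on the smaller tree, with a source at its leaves given by the residuals of the
new layer. The energy of that source is at most a constant times the number of edges, of order `k *
ū ^ k`, by the energy identity of least squares (`Bounds.sum_lastEnergy_le`). Its influence on the
root decays with the depth by a Combes–Thomas argument: the equations are tested against the
difference multiplied by `w ^ (2 * depth)`. By `weighted_flux_le` the weight costs only the fraction
`h` of the joint information, where `w ^ 2 + 1 = 2 * (1 + h) * w`, and coercivity survives as long
as `h * (u + 1) * G < a` (`Bounds.resid_sub_le`, `Bounds.estimate_sub_le`).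

For the constants of the network, coercivity is available for every `w` in `(ι, 1)`. `exists_weight`
takes `w > ι` with `w ^ 2 < ι`, so that the geometric gap absorbs the factor linear in `k`. The
squared change is then of order `(ū ι) ^ N`, and `ζ ≥ 2` gives `√(ū ι) ≤ κ`. The second summand of
`χ` already suffices as the constant; the first one only has to be nonnegative. -/

namespace DistributedWLS

open scoped Matrix Matrix.Norms.L2Operator

/-! ### Completing squares in quadratic forms -/

section QuadraticForms

variable {n : Type*} [Fintype n] {A : Matrix n n ℝ}

theorem dotProduct_mulVec_symm (hA : A.PosSemidef) (x y : n → ℝ) :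
    x ⬝ᵥ A *ᵥ y = y ⬝ᵥ A *ᵥ x := by
  have h : Aᵀ = A := by simpa [Matrix.IsHermitian] using hA.isHermitian
  rw [Matrix.dotProduct_mulVec, ← Matrix.mulVec_transpose, h, dotProduct_comm]

theorem quadForm_nonneg (hA : A.PosSemidef) (x : n → ℝ) : 0 ≤ x ⬝ᵥ A *ᵥ x := by
  simpa using hA.dotProduct_mulVec_nonneg x

theorem quadForm_add_smul_nonneg (hA : A.PosSemidef) (x y : n → ℝ) (s : ℝ) :
    0 ≤ x ⬝ᵥ A *ᵥ x + 2 * s * (x ⬝ᵥ A *ᵥ y) + s ^ 2 * (y ⬝ᵥ A *ᵥ y) := by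
  have h := quadForm_nonneg hA (x + s • y)
  have hs := dotProduct_mulVec_symm hA y x
  simp only [Matrix.mulVec_add, Matrix.mulVec_smul, add_dotProduct, dotProduct_add,
    smul_dotProduct, dotProduct_smul, smul_eq_mul, hs] at h
  nlinarith [h]

theorem dotProduct_mul_le (x y : n → ℝ) {g : ℝ} (hg : 0 < g) :
    x ⬝ᵥ y ≤ g * (x ⬝ᵥ x) + y ⬝ᵥ y / (4 * g) := by
  classical
  have h := quadForm_add_smul_nonneg (A := (1 : Matrix n n ℝ)) Matrix.PosSemidef.one x y
    (-(1 / (2 * g)))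
  simp only [Matrix.one_mulVec] at h
  have h2 := mul_nonneg hg.le h
  have e : g * (x ⬝ᵥ x + 2 * -(1 / (2 * g)) * (x ⬝ᵥ y) + (-(1 / (2 * g))) ^ 2 * (y ⬝ᵥ y)) =
      g * (x ⬝ᵥ x) + y ⬝ᵥ y / (4 * g) - x ⬝ᵥ y := by
    field_simp
    ring
  linarith

theorem sum_dotProduct_self_le {ι : Type*} (s : Finset ι) (f : ι → n → ℝ) :
    (∑ c ∈ s, f c) ⬝ᵥ (∑ c ∈ s, f c) ≤ s.card * ∑ c ∈ s, f c ⬝ᵥ f c := by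
  have h : ∀ k, (∑ c ∈ s, f c) k * (∑ c ∈ s, f c) k ≤ s.card * ∑ c ∈ s, f c k * f c k := by
    intro k
    have := sq_sum_le_card_mul_sum_sq (s := s) (f := fun c => f c k)
    simpa [Finset.sum_apply, sq] using this
  calc _ ≤ ∑ k, s.card * ∑ c ∈ s, f c k * f c k := Finset.sum_le_sum fun k _ => h k
    _ = _ := by
      rw [← Finset.mul_sum, Finset.sum_comm]
      rfl

variable [DecidableEq n]

theorem neg_quadForm_inv_le (hA : A.PosDef) (x z : n → ℝ) :
    -(z ⬝ᵥ A⁻¹ *ᵥ z) / 4 ≤ x ⬝ᵥ A⁻¹ *ᵥ x - x ⬝ᵥ A⁻¹ *ᵥ z := by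
  have := quadForm_add_smul_nonneg hA.inv.posSemidef x z (-(1 / 2))
  linarith

theorem mulVec_inv_mulVec (hA : A.PosDef) (z : n → ℝ) : A *ᵥ A⁻¹ *ᵥ z = z := by
  rw [Matrix.mulVec_mulVec, Matrix.mul_nonsing_inv _ hA.det_pos.ne'.isUnit, Matrix.one_mulVec]

theorem inv_mulVec_mulVec (hA : A.PosDef) (z : n → ℝ) : A⁻¹ *ᵥ A *ᵥ z = z := by
  rw [Matrix.mulVec_mulVec, Matrix.nonsing_inv_mul _ hA.det_pos.ne'.isUnit, Matrix.one_mulVec]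

theorem neg_quadForm_inv_le_sub (hA : A.PosDef) (x z : n → ℝ) :
    -(z ⬝ᵥ A⁻¹ *ᵥ z) / 4 ≤ x ⬝ᵥ A *ᵥ x - x ⬝ᵥ z := by
  have := quadForm_add_smul_nonneg hA.posSemidef x (A⁻¹ *ᵥ z) (-(1 / 2))
  rw [mulVec_inv_mulVec hA, dotProduct_comm (A⁻¹ *ᵥ z)] at this
  linarith

/-- Completing the square here spends only half of the quadratic term; the half that is kept becomes
the energy of the last layer. -/
theorem half_quadForm_sub_le (hA : A.PosDef) (x z : n → ℝ) :
    (x ⬝ᵥ A *ᵥ x) / 2 - (z ⬝ᵥ A⁻¹ *ᵥ z) / 2 ≤ x ⬝ᵥ A *ᵥ x - x ⬝ᵥ z := by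
  have := quadForm_add_smul_nonneg hA.posSemidef x (A⁻¹ *ᵥ z) (-1)
  rw [mulVec_inv_mulVec hA, dotProduct_comm (A⁻¹ *ᵥ z)] at this
  linarith

/-- The weighted flux through an edge whose residual is `s = -A⁻¹ (p + q)`. -/
theorem weighted_flux_le (hA : A.PosDef) {p q s : n → ℝ} (hs : A *ᵥ s = -(p + q)) {w h : ℝ}
    (hh : 0 ≤ h) (hw : w ^ 2 + 1 = 2 * (1 + h) * w) :
    s ⬝ᵥ p + w ^ 2 * (s ⬝ᵥ q) ≤ h * (p ⬝ᵥ A⁻¹ *ᵥ p + w ^ 2 * (q ⬝ᵥ A⁻¹ *ᵥ q)) := by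
  have hs' : s = A⁻¹ *ᵥ (-(p + q)) := by rw [← hs, inv_mulVec_mulVec hA]
  have h1 := quadForm_add_smul_nonneg hA.inv.posSemidef p q w
  have hsy := dotProduct_mulVec_symm hA.inv.posSemidef q p
  have e1 : s ⬝ᵥ p = -(p ⬝ᵥ A⁻¹ *ᵥ p + p ⬝ᵥ A⁻¹ *ᵥ q) := by
    rw [dotProduct_comm, hs', Matrix.mulVec_neg, Matrix.mulVec_add, dotProduct_neg, dotProduct_add]
  have e2 : s ⬝ᵥ q = -(p ⬝ᵥ A⁻¹ *ᵥ q + q ⬝ᵥ A⁻¹ *ᵥ q) := by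
    rw [dotProduct_comm, hs', Matrix.mulVec_neg, Matrix.mulVec_add, dotProduct_neg,
      dotProduct_add, hsy]
  rw [e1, e2]
  -- The claim is `(1 + h)` times the square of `p + w • q`; the relation between `w` and `h` makes
  -- the cross terms agree.
  have h2 := mul_nonneg (by linarith : (0 : ℝ) ≤ 1 + h) h1
  have h3 : w ^ 2 * (p ⬝ᵥ A⁻¹ *ᵥ q) + p ⬝ᵥ A⁻¹ *ᵥ q = 2 * (1 + h) * w * (p ⬝ᵥ A⁻¹ *ᵥ q) := by
    rw [← hw]; ring
  linarith

end QuadraticForms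

end DistributedWLS

namespace DistributedWLS.Network

open scoped Matrix Matrix.Norms.L2Operator

variable {V : Type*} [Fintype V] (W : DistributedWLS.Network V)

/-! ### Positivity of the messages -/

theorem mem_nbrs {i j : V} : j ∈ W.nbrs i ↔ W.graph.Adj i j := by
  simp [nbrs]

open scoped Classical in
/-- The neighbors of `i` other than `j`. -/
noncomputable def others (i j : V) : Finset V := (W.nbrs i).filter (fun c => c ≠ j)

theorem adj_of_mem_others {i j c : V} (h : c ∈ W.others i j) : W.graph.Adj c i := by
  classical
  exact ((W.mem_nbrs).1 (Finset.mem_filter.1 h).1).symm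

theorem sum_nbrs_sub {M : Type*} [AddCommGroup M] {i j : V} (h : W.graph.Adj i j) (f : V → M) :
    ∑ c ∈ W.nbrs i, f c - f j = ∑ c ∈ W.others i j, f c := by
  classical
  have h1 : W.others i j = (W.nbrs i).erase j := by
    ext c
    simp [others, and_comm]
  rw [h1, ← Finset.add_sum_erase _ _ ((W.mem_nbrs).2 h)]
  abel

theorem card_others {i j : V} (h : W.graph.Adj i j) :
    ((W.others i j).card : ℝ) = (W.nbrs i).card - 1 := by
  have := W.sum_nbrs_sub h (fun _ => (1 : ℝ))
  simpa using this.symm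

theorem gatherMat_sub {P : ∀ _ i : V, Matrix (Fin (W.n i)) (Fin (W.n i)) ℝ} {i j : V}
    (h : W.graph.Adj i j) :
    W.gatherMat P i - P j i = W.selfInfo i + ∑ c ∈ W.others i j, P c i := by
  rw [gatherMat, add_sub_assoc, W.sum_nbrs_sub h (fun c => P c i)]

theorem gatherVec_sub {a : ∀ _ i : V, Fin (W.n i) → ℝ} {i j : V} (h : W.graph.Adj i j) :
    W.gatherVec a i - a j i =
      ((W.C i)ᵀ * (W.R i)⁻¹) *ᵥ W.z i + ∑ c ∈ W.others i j, a c i := by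
  rw [gatherVec, add_sub_assoc, W.sum_nbrs_sub h (fun c => a c i)]

theorem msgCov_posDef {P : ∀ _ i : V, Matrix (Fin (W.n i)) (Fin (W.n i)) ℝ} {i j : V}
    (h : W.graph.Adj i j) (hP : (W.gatherMat P i - P j i).PosDef) : (W.msgCov P i j).PosDef := by
  have := hP.inv.posSemidef.mul_mul_conjTranspose_same (W.CJ s(i, j) i)
  rw [Matrix.conjTranspose_eq_transpose_of_trivial] at this
  exact (W.RJ_posDef s(i, j) h).add_posSemidef this

theorem gatherMat_sub_posDef (hlocal : ∀ i, (W.selfInfo i).PosDef)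
    {P : ∀ _ i : V, Matrix (Fin (W.n i)) (Fin (W.n i)) ℝ}
    (hP : ∀ i j, W.graph.Adj i j → (P i j).PosSemidef) {i j : V} (h : W.graph.Adj i j) :
    (W.gatherMat P i - P j i).PosDef := by
  rw [W.gatherMat_sub h]
  exact (hlocal i).add_posSemidef
    (Matrix.posSemidef_sum _ fun c hc => hP c i (W.adj_of_mem_others hc))

/-- Semidefinite incoming messages keep the cavity matrix at least as large as the self information,
hence invertible, and this makes the next message semidefinite. -/
theorem matMsg_posSemidef (hlocal : ∀ i, (W.selfInfo i).PosDef) (k : ℕ) :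
    ∀ i j, W.graph.Adj i j → (W.matMsg k i j).PosSemidef := by
  induction k with
  | zero => intro i j _; exact Matrix.PosSemidef.zero
  | succ k ih =>
    intro i j h
    have := (W.msgCov_posDef h
      (W.gatherMat_sub_posDef hlocal ih h)).inv.posSemidef.conjTranspose_mul_mul_same
        (W.CJ s(i, j) j)
    rwa [Matrix.conjTranspose_eq_transpose_of_trivial] at this

theorem gatherMat_posDef (hlocal : ∀ i, (W.selfInfo i).PosDef) (k : ℕ) (i : V) :
    (W.gatherMat (W.matMsg k) i).PosDef :=
  (hlocal i).add_posSemidef (Matrix.posSemidef_sum _ fun c hc =>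
    W.matMsg_posSemidef hlocal k c i ((W.mem_nbrs).1 hc).symm)

/-! ### Back substitution

Given the state `y` of node `j`, the estimate of the state of its neighbor `i` in the branch of the
computation tree of depth `k` that starts with the edge from `j` to `i`. -/

/-- The residual of the joint measurement of `i` and `j`, weighted by the inverse covariance,
given the state `y` of node `j`. -/
noncomputable def resid (k : ℕ) (i j : V) (y : Fin (W.n j) → ℝ) : Fin (W.mJ s(i, j)) → ℝ :=
  (W.msgCov (W.matMsg k) i j)⁻¹ *ᵥ
    (W.msgMeas (W.matMsg k) (W.vecMsg k) i j - W.CJ s(i, j) j *ᵥ y)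

/-- The estimate of the state of node `i`, given the state `y` of node `j`. -/
noncomputable def child (k : ℕ) (i j : V) (y : Fin (W.n j) → ℝ) : Fin (W.n i) → ℝ :=
  W.cavityCov (W.matMsg k) i j *ᵥ
    (W.gatherVec (W.vecMsg k) i - W.vecMsg k j i + (W.CJ s(i, j) i)ᵀ *ᵥ W.resid k i j y)

variable {W}

/-- A pair of messages encodes an affine function of the receiver's state: the force that the whole
branch behind `i` exerts on `j`. -/
theorem vecMsg_sub_matMsg (k : ℕ) (i j : V) (y : Fin (W.n j) → ℝ) :
    W.vecMsg (k + 1) i j - W.matMsg (k + 1) i j *ᵥ y =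
      (W.CJ s(i, j) j)ᵀ *ᵥ W.resid k i j y := by
  simp only [vecMsg, matMsg, resid, Matrix.mulVec_sub, Matrix.mulVec_mulVec, Matrix.mul_assoc]

/-- Undoes the elimination of node `i`: `resid`, defined through the marginal covariance, is also
the residual at the child's state weighted by the original covariance. -/
theorem RJ_mulVec_resid (hlocal : ∀ i, (W.selfInfo i).PosDef) (k : ℕ) {i j : V}
    (h : W.graph.Adj i j) (y : Fin (W.n j) → ℝ) :
    W.RJ s(i, j) *ᵥ W.resid k i j y =
      W.zJ s(i, j) - W.CJ s(i, j) i *ᵥ W.child k i j y - W.CJ s(i, j) j *ᵥ y := by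
  have hpd := W.msgCov_posDef h (W.gatherMat_sub_posDef hlocal (W.matMsg_posSemidef hlocal k) h)
  have h1 := mulVec_inv_mulVec hpd (W.msgMeas (W.matMsg k) (W.vecMsg k) i j - W.CJ s(i, j) j *ᵥ y)
  change W.msgCov (W.matMsg k) i j *ᵥ W.resid k i j y = _ at h1
  rw [msgCov, Matrix.add_mulVec] at h1
  rw [eq_sub_of_add_eq h1, child, msgMeas, Matrix.mulVec_add, Matrix.mulVec_add,
    Matrix.mulVec_mulVec, Matrix.mulVec_mulVec, Matrix.mulVec_mulVec, Matrix.mul_assoc]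
  abel

/-- The normal equation at an inner node of the tree: the forces from its own measurement, its
children and its parent balance. -/
theorem selfInfo_mulVec_child (hlocal : ∀ i, (W.selfInfo i).PosDef) (k : ℕ) {i j : V}
    (h : W.graph.Adj i j) (y : Fin (W.n j) → ℝ) :
    W.selfInfo i *ᵥ W.child k i j y =
      ((W.C i)ᵀ * (W.R i)⁻¹) *ᵥ W.z i +
        ∑ c ∈ W.others i j, (W.vecMsg k c i - W.matMsg k c i *ᵥ W.child k i j y) +
        (W.CJ s(i, j) i)ᵀ *ᵥ W.resid k i j y := by
  have hpd := W.gatherMat_sub_posDef hlocal (W.matMsg_posSemidef hlocal k) h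
  have h1 := mulVec_inv_mulVec hpd (W.gatherVec (W.vecMsg k) i - W.vecMsg k j i +
    (W.CJ s(i, j) i)ᵀ *ᵥ W.resid k i j y)
  change _ *ᵥ W.child k i j y = _ at h1
  rw [W.gatherMat_sub h, W.gatherVec_sub h, Matrix.add_mulVec, Matrix.sum_mulVec] at h1
  rw [eq_sub_of_add_eq h1, Finset.sum_sub_distrib]
  abel

theorem selfInfo_mulVec_child_zero (hlocal : ∀ i, (W.selfInfo i).PosDef) {i j : V}
    (h : W.graph.Adj i j) (y : Fin (W.n j) → ℝ) :
    W.selfInfo i *ᵥ W.child 0 i j y = ((W.C i)ᵀ * (W.R i)⁻¹) *ᵥ W.z i +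
      (W.CJ s(i, j) i)ᵀ *ᵥ W.resid 0 i j y := by
  rw [selfInfo_mulVec_child hlocal 0 h]
  simp [vecMsg, matMsg]

theorem selfInfo_mulVec_child_succ (hlocal : ∀ i, (W.selfInfo i).PosDef) (k : ℕ) {i j : V}
    (h : W.graph.Adj i j) (y : Fin (W.n j) → ℝ) :
    W.selfInfo i *ᵥ W.child (k + 1) i j y =
      ((W.C i)ᵀ * (W.R i)⁻¹) *ᵥ W.z i +
        ∑ c ∈ W.others i j, (W.CJ s(c, i) i)ᵀ *ᵥ W.resid k c i (W.child (k + 1) i j y) +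
        (W.CJ s(i, j) i)ᵀ *ᵥ W.resid (k + 1) i j y := by
  rw [selfInfo_mulVec_child hlocal (k + 1) h]
  simp only [vecMsg_sub_matMsg]

theorem selfInfo_mulVec_root (hlocal : ∀ i, (W.selfInfo i).PosDef) (k : ℕ) (i : V)
    {x : Fin (W.n i) → ℝ} (hx : x = (W.infoMat (k + 1) i)⁻¹ *ᵥ W.infoVec (k + 1) i) :
    W.selfInfo i *ᵥ x = ((W.C i)ᵀ * (W.R i)⁻¹) *ᵥ W.z i +
      ∑ c ∈ W.nbrs i, (W.vecMsg k c i - W.matMsg k c i *ᵥ x) := by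
  have h1 : W.gatherMat (W.matMsg k) i *ᵥ x = W.gatherVec (W.vecMsg k) i := by
    rw [hx]
    exact mulVec_inv_mulVec (W.gatherMat_posDef hlocal k i) _
  rw [gatherMat, gatherVec, Matrix.add_mulVec, Matrix.sum_mulVec] at h1
  rw [eq_sub_of_add_eq h1, Finset.sum_sub_distrib]
  abel

theorem selfInfo_mulVec_root_one (hlocal : ∀ i, (W.selfInfo i).PosDef) (i : V)
    {x : Fin (W.n i) → ℝ} (hx : x = (W.infoMat 1 i)⁻¹ *ᵥ W.infoVec 1 i) :
    W.selfInfo i *ᵥ x = ((W.C i)ᵀ * (W.R i)⁻¹) *ᵥ W.z i := by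
  rw [selfInfo_mulVec_root hlocal 0 i hx]
  simp [vecMsg, matMsg]

theorem selfInfo_mulVec_root_succ (hlocal : ∀ i, (W.selfInfo i).PosDef) (k : ℕ) (i : V)
    {x : Fin (W.n i) → ℝ} (hx : x = (W.infoMat (k + 2) i)⁻¹ *ᵥ W.infoVec (k + 2) i) :
    W.selfInfo i *ᵥ x = ((W.C i)ᵀ * (W.R i)⁻¹) *ᵥ W.z i +
      ∑ c ∈ W.nbrs i, (W.CJ s(c, i) i)ᵀ *ᵥ W.resid k c i x := by
  rw [selfInfo_mulVec_root hlocal (k + 1) i hx]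
  simp only [vecMsg_sub_matMsg]

/-! ### The energy of the last layer -/

variable (W) in
/-- The energy of the residuals in the last layer of a branch of the computation tree. -/
noncomputable def lastEnergy : ℕ → ∀ _ j : V, (Fin (W.n j) → ℝ) → ℝ
  | 0, i, j, y => W.resid 0 i j y ⬝ᵥ W.RJ s(i, j) *ᵥ W.resid 0 i j y
  | k + 1, i, j, y => ∑ c ∈ W.others i j, lastEnergy k c i (W.child (k + 1) i j y)

/-- `1 + u + ⋯ + u ^ k`. -/
noncomputable def branchCard (u : ℝ) : ℕ → ℝ
  | 0 => 1
  | k + 1 => 1 + u * branchCard u k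

theorem branchCard_pos {u : ℝ} (hu : 0 ≤ u) (k : ℕ) : 0 < branchCard u k := by
  induction k with
  | zero => simp [branchCard]
  | succ k ih => simp only [branchCard]; positivity

theorem branchCard_le {u : ℝ} (hu : 1 ≤ u) (k : ℕ) : branchCard u k ≤ (k + 1) * u ^ k := by
  induction k with
  | zero => simp [branchCard]
  | succ k ih =>
    simp only [branchCard]
    have h1 : u * branchCard u k ≤ u * ((k + 1) * u ^ k) := by gcongr
    have h2 : 1 ≤ u ^ (k + 1) := one_le_pow₀ hu
    push_cast
    rw [pow_succ] at *
    nlinarith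

variable (W) in
/-- Bounds for the data of the network: `a` bounds the self information from below, `G` bounds the
joint information, `b` the weighted measurements, and `u + 1` the number of neighbors. -/
structure Bounds (a G b u : ℝ) : Prop where
  G_nonneg : 0 ≤ G
  u_nonneg : 0 ≤ u
  self : ∀ i x, a * (x ⬝ᵥ x) ≤ x ⬝ᵥ W.selfInfo i *ᵥ x
  joint : ∀ e ∈ W.graph.edgeSet, ∀ i ∈ e, ∀ x,
    (W.CJ e i *ᵥ x) ⬝ᵥ (W.RJ e)⁻¹ *ᵥ (W.CJ e i *ᵥ x) ≤ G * (x ⬝ᵥ x)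
  joint_transpose : ∀ e ∈ W.graph.edgeSet, ∀ i ∈ e, ∀ r,
    ((W.CJ e i)ᵀ *ᵥ r) ⬝ᵥ ((W.CJ e i)ᵀ *ᵥ r) ≤ G * (r ⬝ᵥ W.RJ e *ᵥ r)
  meas : ∀ i, W.z i ⬝ᵥ (W.R i)⁻¹ *ᵥ W.z i ≤ b
  joint_meas : ∀ e ∈ W.graph.edgeSet, W.zJ e ⬝ᵥ (W.RJ e)⁻¹ *ᵥ W.zJ e ≤ b
  card : ∀ i, ((W.nbrs i).card : ℝ) ≤ u + 1

section Estimates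

variable {a G b u : ℝ}

theorem Bounds.meas_nonneg (B : W.Bounds a G b u) (i : V) : 0 ≤ b :=
  (quadForm_nonneg (W.R_posDef i).inv.posSemidef _).trans (B.meas i)

theorem Bounds.card_others_le (B : W.Bounds a G b u) {i j : V} (h : W.graph.Adj i j) :
    ((W.others i j).card : ℝ) ≤ u := by
  rw [W.card_others h]
  linarith [B.card i]

theorem transpose_mulVec_dotProduct {m n : Type*} [Fintype m] [Fintype n] (A : Matrix m n ℝ)
    (x : n → ℝ) (r : m → ℝ) : x ⬝ᵥ Aᵀ *ᵥ r = r ⬝ᵥ A *ᵥ x := by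
  rw [Matrix.mulVec_transpose, dotProduct_comm, Matrix.dotProduct_mulVec]

/-- Both terms depend on `x` only through `C i *ᵥ x`, so the square is completed in the norm of `(R
i)⁻¹`. -/
theorem Bounds.self_energy (B : W.Bounds a G b u) (i : V) (x : Fin (W.n i) → ℝ) :
    -b / 4 ≤ x ⬝ᵥ W.selfInfo i *ᵥ x - x ⬝ᵥ ((W.C i)ᵀ * (W.R i)⁻¹) *ᵥ W.z i := by
  have h := neg_quadForm_inv_le (W.R_posDef i) (W.C i *ᵥ x) (W.z i)
  have e1 : x ⬝ᵥ W.selfInfo i *ᵥ x = (W.C i *ᵥ x) ⬝ᵥ (W.R i)⁻¹ *ᵥ (W.C i *ᵥ x) := by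
    rw [selfInfo, Matrix.mul_assoc, ← Matrix.mulVec_mulVec, transpose_mulVec_dotProduct,
      ← Matrix.mulVec_mulVec, dotProduct_comm]
  have e2 : x ⬝ᵥ ((W.C i)ᵀ * (W.R i)⁻¹) *ᵥ W.z i = (W.C i *ᵥ x) ⬝ᵥ (W.R i)⁻¹ *ᵥ W.z i := by
    rw [← Matrix.mulVec_mulVec, transpose_mulVec_dotProduct, dotProduct_comm]
  rw [e1, e2]
  linarith [B.meas i]

/-- Pairing each normal equation with its own unknown and adding makes the internal edge terms
telescope, leaving the flux through the top edge. Every node and edge outside the last layer costs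
at most `b / 4`; a last edge costs `b / 2` because half of its energy is kept. After doubling, this
is at most `3 / 2 * b` per node with its parent edge. -/
theorem Bounds.lastEnergy_le (B : W.Bounds a G b u) (hlocal : ∀ i, (W.selfInfo i).PosDef)
    (k : ℕ) : ∀ {i j : V}, W.graph.Adj i j → ∀ y : Fin (W.n j) → ℝ,
      W.lastEnergy k i j y ≤ 3 / 2 * b * branchCard u k -
        2 * (W.resid k i j y ⬝ᵥ W.CJ s(i, j) j *ᵥ y) := by
  induction k with
  | zero =>
    intro i j h y
    have h1 := congrArg (W.child 0 i j y ⬝ᵥ ·) (selfInfo_mulVec_child_zero hlocal h y)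
    have h2 := congrArg (W.resid 0 i j y ⬝ᵥ ·) (RJ_mulVec_resid hlocal 0 h y)
    simp only [dotProduct_add, dotProduct_sub, transpose_mulVec_dotProduct] at h1 h2
    have h3 := B.self_energy i (W.child 0 i j y)
    have h4 := half_quadForm_sub_le (W.RJ_posDef _ h) (W.resid 0 i j y) (W.zJ s(i, j))
    have h5 := B.joint_meas s(i, j) h
    simp only [lastEnergy, branchCard]
    linarith
  | succ k ih =>
    intro i j h y
    have h1 := congrArg (W.child (k + 1) i j y ⬝ᵥ ·) (selfInfo_mulVec_child_succ hlocal k h y)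
    have h2 := congrArg (W.resid (k + 1) i j y ⬝ᵥ ·) (RJ_mulVec_resid hlocal (k + 1) h y)
    simp only [dotProduct_add, dotProduct_sub, dotProduct_sum,
      transpose_mulVec_dotProduct] at h1 h2
    have h3 := B.self_energy i (W.child (k + 1) i j y)
    have h4 := neg_quadForm_inv_le_sub (W.RJ_posDef _ h) (W.resid (k + 1) i j y) (W.zJ s(i, j))
    have h5 := B.joint_meas s(i, j) h
    have h6 := Finset.sum_le_sum fun c (hc : c ∈ W.others i j) =>
      ih (W.adj_of_mem_others hc) (W.child (k + 1) i j y)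
    rw [Finset.sum_sub_distrib, Finset.sum_const, ← Finset.mul_sum, nsmul_eq_mul] at h6
    have h7 : ((W.others i j).card : ℝ) * (3 / 2 * b * branchCard u k) ≤
        u * (3 / 2 * b * branchCard u k) := by
      have := branchCard_pos B.u_nonneg k
      have := B.meas_nonneg i
      gcongr
      exact B.card_others_le h
    simp only [lastEnergy, branchCard]
    linarith [B.meas_nonneg i]

/-- The total energy of the last layer of the computation tree. -/
theorem Bounds.sum_lastEnergy_le (B : W.Bounds a G b u) (hlocal : ∀ i, (W.selfInfo i).PosDef)
    (k : ℕ) (i : V) {x : Fin (W.n i) → ℝ}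
    (hx : x = (W.infoMat (k + 2) i)⁻¹ *ᵥ W.infoVec (k + 2) i) :
    ∑ c ∈ W.nbrs i, W.lastEnergy k c i x ≤ 3 / 2 * b * (1 + (u + 1) * branchCard u k) := by
  have h1 := congrArg (x ⬝ᵥ ·) (selfInfo_mulVec_root_succ hlocal k i hx)
  simp only [dotProduct_add, dotProduct_sum, transpose_mulVec_dotProduct] at h1
  have h3 := B.self_energy i x
  have h6 := Finset.sum_le_sum fun c (hc : c ∈ W.nbrs i) =>
    B.lastEnergy_le hlocal k ((W.mem_nbrs).1 hc).symm x
  rw [Finset.sum_sub_distrib, Finset.sum_const, ← Finset.mul_sum, nsmul_eq_mul] at h6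
  have h7 : ((W.nbrs i).card : ℝ) * (3 / 2 * b * branchCard u k) ≤
      (u + 1) * (3 / 2 * b * branchCard u k) := by
    have := branchCard_pos B.u_nonneg k
    have := B.meas_nonneg i
    gcongr
    exact B.card i
  linarith [B.meas_nonneg i]

/-! ### Decay of a perturbation of the last layer -/

/-- Controls the source: the total force of the newly added leaves on a former leaf, in terms of
their energy. -/
theorem Bounds.sum_transpose_resid_le (B : W.Bounds a G b u) (i : V) (s : Finset V) {D : ℝ}
    (hs : ∀ c ∈ s, W.graph.Adj c i) (hD : (s.card : ℝ) ≤ D) (x : Fin (W.n i) → ℝ) :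
    (∑ c ∈ s, (W.CJ s(c, i) i)ᵀ *ᵥ W.resid 0 c i x) ⬝ᵥ
      (∑ c ∈ s, (W.CJ s(c, i) i)ᵀ *ᵥ W.resid 0 c i x) ≤
      D * G * ∑ c ∈ s, W.lastEnergy 0 c i x := by
  have h1 := Finset.sum_le_sum fun c hc =>
    B.joint_transpose s(c, i) (hs c hc) i (by simp) (W.resid 0 c i x)
  have h0 : 0 ≤ ∑ c ∈ s, ((W.CJ s(c, i) i)ᵀ *ᵥ W.resid 0 c i x) ⬝ᵥ
      ((W.CJ s(c, i) i)ᵀ *ᵥ W.resid 0 c i x) :=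
    Finset.sum_nonneg fun c _ => Finset.sum_nonneg fun _ _ => mul_self_nonneg _
  rw [← Finset.mul_sum] at h1
  calc _ ≤ _ := sum_dotProduct_self_le s _
    _ ≤ D * (G * ∑ c ∈ s, W.lastEnergy 0 c i x) :=
      mul_le_mul hD h1 h0 ((Nat.cast_nonneg _).trans hD)
    _ = _ := by ring

/-- Crossing an edge gains a factor `w ^ 2` at the price of `h * G` at both ends. A node other than
the root pays this price for at most `u` child edges and its parent edge, which the self information
`a` covers by `hga`. The surplus `g` is spent only where the source acts, on the leaves of the
shorter tree. -/
theorem Bounds.resid_sub_le (B : W.Bounds a G b u) (hlocal : ∀ i, (W.selfInfo i).PosDef)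
    {w h g : ℝ} (hh : 0 ≤ h) (hw : w ^ 2 + 1 = 2 * (1 + h) * w)
    (hg : 0 < g) (hga : g ≤ a - h * (u + 1) * G) (k : ℕ) :
    ∀ {i j : V}, W.graph.Adj i j → ∀ y y' : Fin (W.n j) → ℝ,
      (W.resid (k + 1) i j y' - W.resid k i j y) ⬝ᵥ W.CJ s(i, j) j *ᵥ (y' - y) ≤
        h * G * ((y' - y) ⬝ᵥ (y' - y)) +
          (w ^ 2) ^ (k + 1) * (((u + 1) * G) / (4 * g) * W.lastEnergy (k + 1) i j y') := by
  have hG := B.G_nonneg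
  have hu := B.u_nonneg
  -- the bound for the flux into the child gives the bound for the flux out of the parent
  have key : ∀ (k : ℕ) {i j : V}, W.graph.Adj i j → ∀ (y y' : Fin (W.n j) → ℝ) (E : ℝ),
      (a - h * u * G - g) * ((W.child (k + 1) i j y' - W.child k i j y) ⬝ᵥ
          (W.child (k + 1) i j y' - W.child k i j y)) - E ≤
        (W.resid (k + 1) i j y' - W.resid k i j y) ⬝ᵥ
          W.CJ s(i, j) i *ᵥ (W.child (k + 1) i j y' - W.child k i j y) →
      (W.resid (k + 1) i j y' - W.resid k i j y) ⬝ᵥ W.CJ s(i, j) j *ᵥ (y' - y) ≤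
        h * G * ((y' - y) ⬝ᵥ (y' - y)) + w ^ 2 * E := by
    intro k i j hij y y' E hE
    set d := W.child (k + 1) i j y' - W.child k i j y with hd
    set s := W.resid (k + 1) i j y' - W.resid k i j y with hs
    have h1 : W.RJ s(i, j) *ᵥ s = -(W.CJ s(i, j) j *ᵥ (y' - y) + W.CJ s(i, j) i *ᵥ d) := by
      rw [hs, hd, Matrix.mulVec_sub, RJ_mulVec_resid hlocal _ hij, RJ_mulVec_resid hlocal _ hij,
        Matrix.mulVec_sub, Matrix.mulVec_sub]
      abel
    have h2 := weighted_flux_le (W.RJ_posDef _ hij) h1 hh hw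
    have h3 := B.joint s(i, j) hij j (by simp) (y' - y)
    have h4 := B.joint s(i, j) hij i (by simp) d
    have h5 : 0 ≤ d ⬝ᵥ d := Finset.sum_nonneg fun _ _ => mul_self_nonneg _
    have h6 := mul_le_mul_of_nonneg_left hE (sq_nonneg w)
    have h7 := mul_le_mul_of_nonneg_left h3 hh
    have h8 := mul_le_mul_of_nonneg_left (mul_le_mul_of_nonneg_left h4 (sq_nonneg w)) hh
    have h9 : 0 ≤ w ^ 2 * ((a - h * (u + 1) * G - g) * (d ⬝ᵥ d)) :=
      mul_nonneg (sq_nonneg w) (mul_nonneg (by linarith) h5)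
    linarith
  induction k with
  | zero =>
    intro i j hij y y'
    have h1 := key 0 hij y y' (((u + 1) * G) / (4 * g) * W.lastEnergy 1 i j y') ?_
    · simpa using h1
    set d := W.child 1 i j y' - W.child 0 i j y with hd
    have h2 : W.selfInfo i *ᵥ d =
        ∑ c ∈ W.others i j, (W.CJ s(c, i) i)ᵀ *ᵥ W.resid 0 c i (W.child 1 i j y') +
          (W.CJ s(i, j) i)ᵀ *ᵥ (W.resid 1 i j y' - W.resid 0 i j y) := by
      rw [hd, Matrix.mulVec_sub, selfInfo_mulVec_child_succ hlocal 0 hij,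
        selfInfo_mulVec_child_zero hlocal hij, Matrix.mulVec_sub]
      abel
    have h3 := congrArg (d ⬝ᵥ ·) h2
    simp only [dotProduct_add] at h3
    rw [transpose_mulVec_dotProduct] at h3
    have h4 := B.self i d
    -- Young's inequality with the spare coercivity `g` trades the source for its squared norm over
    -- `4 * g`.
    have h5 := dotProduct_mul_le d
      (∑ c ∈ W.others i j, (W.CJ s(c, i) i)ᵀ *ᵥ W.resid 0 c i (W.child 1 i j y')) hg
    have h6 := B.sum_transpose_resid_le i (W.others i j) (fun c hc => W.adj_of_mem_others hc)
      ((B.card_others_le hij).trans (by linarith : u ≤ u + 1)) (W.child 1 i j y')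
    have h7 := div_le_div_of_nonneg_right h6 (by positivity : 0 ≤ 4 * g)
    have h8 : 0 ≤ d ⬝ᵥ d := Finset.sum_nonneg fun _ _ => mul_self_nonneg _
    have h9 : 0 ≤ h * u * G * (d ⬝ᵥ d) := by positivity
    have h10 : (u + 1) * G / (4 * g) * W.lastEnergy 1 i j y' =
      (u + 1) * G * (∑ c ∈ W.others i j, W.lastEnergy 0 c i (W.child 1 i j y')) / (4 * g) := by
      simp only [lastEnergy]; ring
    rw [h10]
    linarith
  | succ k ih =>
    intro i j hij y y'
    have h1 := key (k + 1) hij y y'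
      ((w ^ 2) ^ (k + 1) * (((u + 1) * G) / (4 * g) * W.lastEnergy (k + 2) i j y')) ?_
    · calc _ ≤ _ := h1
        _ = _ := by ring
    set d := W.child (k + 2) i j y' - W.child (k + 1) i j y with hd
    have h2 : W.selfInfo i *ᵥ d =
        ∑ c ∈ W.others i j, (W.CJ s(c, i) i)ᵀ *ᵥ (W.resid (k + 1) c i (W.child (k + 2) i j y') -
            W.resid k c i (W.child (k + 1) i j y)) +
          (W.CJ s(i, j) i)ᵀ *ᵥ (W.resid (k + 2) i j y' - W.resid (k + 1) i j y) := by
      rw [hd, Matrix.mulVec_sub, selfInfo_mulVec_child_succ hlocal (k + 1) hij,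
        selfInfo_mulVec_child_succ hlocal k hij]
      simp only [Matrix.mulVec_sub, Finset.sum_sub_distrib]
      abel
    have h3 := congrArg (d ⬝ᵥ ·) h2
    simp only [dotProduct_add, dotProduct_sum, transpose_mulVec_dotProduct] at h3
    have h4 := B.self i d
    have h5 := Finset.sum_le_sum fun c (hc : c ∈ W.others i j) => ih (W.adj_of_mem_others hc)
      (W.child (k + 1) i j y) (W.child (k + 2) i j y')
    rw [Finset.sum_add_distrib, Finset.sum_const, ← Finset.mul_sum, ← Finset.mul_sum,
      nsmul_eq_mul, ← hd] at h5
    have h8 : 0 ≤ d ⬝ᵥ d := Finset.sum_nonneg fun _ _ => mul_self_nonneg _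
    have h9 : ((W.others i j).card : ℝ) * (h * G * (d ⬝ᵥ d)) ≤ u * (h * G * (d ⬝ᵥ d)) := by
      gcongr
      exact B.card_others_le hij
    have h10 : W.lastEnergy (k + 2) i j y' =
      ∑ c ∈ W.others i j, W.lastEnergy (k + 1) c i (W.child (k + 2) i j y') := rfl
    rw [h10]
    have h11 := mul_nonneg hg.le h8
    linarith

/-- The change of the estimate from one iteration to the next. -/
theorem Bounds.estimate_sub_le (B : W.Bounds a G b u) (hlocal : ∀ i, (W.selfInfo i).PosDef)
    {w h g : ℝ} (hh : 0 ≤ h) (hw : w ^ 2 + 1 = 2 * (1 + h) * w)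
    (hg : 0 < g) (hga : g ≤ a - h * (u + 1) * G) (k : ℕ) (i : V) :
    g ^ 2 * ‖W.estimate (k + 2) i - W.estimate (k + 1) i‖ ^ 2 ≤
      (w ^ 2) ^ k * ((u + 1) * G * (3 / 2 * b * (1 + (u + 1) * branchCard u k))) := by
  have hG := B.G_nonneg
  have hu := B.u_nonneg
  obtain ⟨x, hx⟩ : ∃ x, x = (W.infoMat (k + 1) i)⁻¹ *ᵥ W.infoVec (k + 1) i := ⟨_, rfl⟩
  obtain ⟨x', hx'⟩ : ∃ x, x = (W.infoMat (k + 2) i)⁻¹ *ᵥ W.infoVec (k + 2) i := ⟨_, rfl⟩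
  have hn : ‖W.estimate (k + 2) i - W.estimate (k + 1) i‖ ^ 2 = (x' - x) ⬝ᵥ (x' - x) := by
    rw [EuclideanSpace.real_norm_sq_eq]
    simp only [estimate, ← hx, ← hx', dotProduct]
    exact Finset.sum_congr rfl fun l _ => by simp [sq]
  have hL := B.sum_lastEnergy_le hlocal k i hx'
  have hr := selfInfo_mulVec_root_succ hlocal k i hx'
  suffices hs : g ^ 2 * ((x' - x) ⬝ᵥ (x' - x)) ≤
      (w ^ 2) ^ k * ((u + 1) * G * ∑ c ∈ W.nbrs i, W.lastEnergy k c i x') by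
    rw [hn]
    refine hs.trans ?_
    gcongr
  have h8 : 0 ≤ (x' - x) ⬝ᵥ (x' - x) := Finset.sum_nonneg fun _ _ => mul_self_nonneg _
  have h4 := B.self i (x' - x)
  cases k with
  | zero =>
    have h3 := congrArg ((x' - x) ⬝ᵥ ·) (congrArg₂ (· - ·) hr (selfInfo_mulVec_root_one hlocal i hx))
    simp only [← Matrix.mulVec_sub, add_sub_cancel_left] at h3
    -- The shorter tree is the root alone, so the source acts on it directly; the parameter `g / 2`
    -- leaves `g / 2` on the left.
    have h5 := dotProduct_mul_le (x' - x)
      (∑ c ∈ W.nbrs i, (W.CJ s(c, i) i)ᵀ *ᵥ W.resid 0 c i x') (half_pos hg)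
    have h6 := B.sum_transpose_resid_le i (W.nbrs i) (fun c hc => ((W.mem_nbrs).1 hc).symm)
      (B.card i) x'
    have h7 : 0 ≤ h * (u + 1) * G * ((x' - x) ⬝ᵥ (x' - x)) := by positivity
    have h9 : g * ((x' - x) ⬝ᵥ (x' - x)) ≤ (a - h * (u + 1) * G) * ((x' - x) ⬝ᵥ (x' - x)) := by
      gcongr
    have h10 : g / 2 * ((x' - x) ⬝ᵥ (x' - x)) ≤
        ((u + 1) * G * ∑ c ∈ W.nbrs i, W.lastEnergy 0 c i x') / (4 * (g / 2)) := by
      have := div_le_div_of_nonneg_right h6 (by positivity : 0 ≤ 4 * (g / 2))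
      linarith
    rw [le_div_iff₀ (by positivity)] at h10
    linarith
  | succ k =>
    have h3 := congrArg ((x' - x) ⬝ᵥ ·)
      (congrArg₂ (· - ·) hr (selfInfo_mulVec_root_succ hlocal k i hx))
    simp only [← Matrix.mulVec_sub, add_sub_add_left_eq_sub, ← Finset.sum_sub_distrib,
      dotProduct_sum, transpose_mulVec_dotProduct] at h3
    have h5 := Finset.sum_le_sum fun c (hc : c ∈ W.nbrs i) =>
      B.resid_sub_le hlocal hh hw hg hga k ((W.mem_nbrs).1 hc).symm x x'
    rw [Finset.sum_add_distrib, Finset.sum_const, ← Finset.mul_sum, ← Finset.mul_sum,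
      nsmul_eq_mul] at h5
    have h9 : ((W.nbrs i).card : ℝ) * (h * G * ((x' - x) ⬝ᵥ (x' - x))) ≤
        (u + 1) * (h * G * ((x' - x) ⬝ᵥ (x' - x))) := by
      gcongr
      exact B.card i
    have h10 : g * ((x' - x) ⬝ᵥ (x' - x)) ≤ (a - h * (u + 1) * G) * ((x' - x) ⬝ᵥ (x' - x)) := by
      gcongr
    have h11 : g * ((x' - x) ⬝ᵥ (x' - x)) ≤
        ((w ^ 2) ^ (k + 1) * ((u + 1) * G * ∑ c ∈ W.nbrs i, W.lastEnergy (k + 1) c i x')) /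
          (4 * g) := by
      calc _ ≤ (w ^ 2) ^ (k + 1) *
          ((u + 1) * G / (4 * g) * ∑ c ∈ W.nbrs i, W.lastEnergy (k + 1) c i x') := by linarith
        _ = _ := by ring
    rw [le_div_iff₀ (by positivity)] at h11
    nlinarith [mul_nonneg (sq_nonneg g) h8]

end Estimates

end DistributedWLS.Network

namespace DistributedWLS

open scoped Matrix Matrix.Norms.L2Operator

/-! ### Spectral norm, smallest singular value and quadratic forms -/

section Spectral

theorem dotProduct_self_eq_norm_sq {n : Type*} [Fintype n] (x : n → ℝ) :
    x ⬝ᵥ x = ‖(WithLp.toLp 2 x : EuclideanSpace ℝ n)‖ ^ 2 := by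
  rw [EuclideanSpace.real_norm_sq_eq]
  exact Finset.sum_congr rfl fun l _ => by simp [sq]

theorem dotProduct_self_nonneg' {n : Type*} [Fintype n] (x : n → ℝ) : 0 ≤ x ⬝ᵥ x :=
  Finset.sum_nonneg fun _ _ => mul_self_nonneg _

theorem mulVec_dotProduct_self_le {m n : Type*} [Fintype m] [Fintype n] [DecidableEq n]
    (A : Matrix m n ℝ) (x : n → ℝ) : (A *ᵥ x) ⬝ᵥ (A *ᵥ x) ≤ ‖A‖ ^ 2 * (x ⬝ᵥ x) := by
  rw [dotProduct_self_eq_norm_sq, dotProduct_self_eq_norm_sq, ← mul_pow]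
  gcongr
  exact A.l2_opNorm_mulVec (WithLp.toLp 2 x)

theorem norm_le_of_mulVec_dotProduct_self_le {m n : Type*} [Fintype m] [Fintype n] [DecidableEq n]
    {A : Matrix m n ℝ} {K : ℝ} (hK : 0 ≤ K)
    (h : ∀ x, (A *ᵥ x) ⬝ᵥ (A *ᵥ x) ≤ K ^ 2 * (x ⬝ᵥ x)) : ‖A‖ ≤ K := by
  rw [Matrix.l2_opNorm_def]
  refine ContinuousLinearMap.opNorm_le_bound _ hK fun x => ?_
  have := h x.ofLp
  rw [dotProduct_self_eq_norm_sq, dotProduct_self_eq_norm_sq, ← mul_pow] at this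
  exact le_of_sq_le_sq this (by positivity)

/-- Avoids the spectral theorem: expand the form of `A` at `x - K⁻¹ • A *ᵥ x` and bound the form at
`A *ᵥ x` by `K` times its squared norm. -/
theorem mulVec_dotProduct_self_le_quadForm {n : Type*} [Fintype n] {A : Matrix n n ℝ}
    (hA : A.PosSemidef) {K : ℝ} (hK : 0 < K)
    (h : ∀ x, (A *ᵥ x) ⬝ᵥ (A *ᵥ x) ≤ K ^ 2 * (x ⬝ᵥ x)) (x : n → ℝ) :
    (A *ᵥ x) ⬝ᵥ (A *ᵥ x) ≤ K * (x ⬝ᵥ A *ᵥ x) := by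
  have h1 := quadForm_add_smul_nonneg hA x (A *ᵥ x) (-(1 / K))
  have h2 := dotProduct_mul_le (A *ᵥ x) (A *ᵥ (A *ᵥ x)) (half_pos hK)
  have h3 := h (A *ᵥ x)
  have h4 := dotProduct_mulVec_symm hA x (A *ᵥ x)
  rw [h4] at h1
  have h5 : (A *ᵥ A *ᵥ x) ⬝ᵥ (A *ᵥ A *ᵥ x) / (4 * (K / 2)) ≤ K / 2 * ((A *ᵥ x) ⬝ᵥ (A *ᵥ x)) := by
    rw [div_le_iff₀ (by positivity)]
    linarith
  have h6 : (A *ᵥ x) ⬝ᵥ A *ᵥ (A *ᵥ x) ≤ K * ((A *ᵥ x) ⬝ᵥ (A *ᵥ x)) := by linarith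
  have h7 := mul_nonneg hK.le h1
  have e : K * (x ⬝ᵥ A *ᵥ x + 2 * -(1 / K) * ((A *ᵥ x) ⬝ᵥ (A *ᵥ x)) +
      (-(1 / K)) ^ 2 * ((A *ᵥ x) ⬝ᵥ A *ᵥ (A *ᵥ x))) =
      K * (x ⬝ᵥ A *ᵥ x) - 2 * ((A *ᵥ x) ⬝ᵥ (A *ᵥ x)) +
        ((A *ᵥ x) ⬝ᵥ A *ᵥ (A *ᵥ x)) / K := by
    field_simp
    ring
  rw [e] at h7
  have h8 : ((A *ᵥ x) ⬝ᵥ A *ᵥ (A *ᵥ x)) / K ≤ (A *ᵥ x) ⬝ᵥ (A *ᵥ x) := by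
    rw [div_le_iff₀ hK]
    linarith
  linarith

theorem mulVec_dotProduct_self_le_norm_mul {n : Type*} [Fintype n] [DecidableEq n]
    {A : Matrix n n ℝ} (hA : A.PosSemidef) (x : n → ℝ) :
    (A *ᵥ x) ⬝ᵥ (A *ᵥ x) ≤ ‖A‖ * (x ⬝ᵥ A *ᵥ x) := by
  rcases (norm_nonneg A).eq_or_lt with h | h
  · have h1 := mulVec_dotProduct_self_le A x
    rw [← h] at h1 ⊢
    linarith
  · exact mulVec_dotProduct_self_le_quadForm hA h (mulVec_dotProduct_self_le A) x

theorem dotProduct_self_le_norm_mul_inv {n : Type*} [Fintype n] [DecidableEq n]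
    {A : Matrix n n ℝ} (hA : A.PosDef) (x : n → ℝ) :
    x ⬝ᵥ x ≤ ‖A‖ * (x ⬝ᵥ A⁻¹ *ᵥ x) := by
  have h := mulVec_dotProduct_self_le_norm_mul hA.posSemidef (A⁻¹ *ᵥ x)
  rwa [mulVec_inv_mulVec hA, dotProduct_comm (A⁻¹ *ᵥ x)] at h

/-- The product `S * M⁻¹` need not be symmetric, so the comparison goes through `T * M = M + S`,
whose form dominates that of `M`. With Cauchy–Schwarz this gives `‖M‖ ≤ ‖T‖ * ‖M‖`. It serves to
show `0 ≤ ξ̄`. -/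
theorem one_le_norm_one_add_mul_inv {n : Type*} [Fintype n] [DecidableEq n] [Nonempty n]
    {S M : Matrix n n ℝ} (hS : S.PosSemidef) (hM : M.PosDef) : 1 ≤ ‖1 + S * M⁻¹‖ := by
  set T := 1 + S * M⁻¹ with hT
  have hTM : ∀ x, T *ᵥ (M *ᵥ x) = M *ᵥ x + S *ᵥ x := by
    intro x
    rw [hT, Matrix.add_mulVec, Matrix.one_mulVec, ← Matrix.mulVec_mulVec, inv_mulVec_mulVec hM]
  have hM0 : 0 < ‖M‖ := by
    rw [norm_pos_iff]
    rintro rfl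
    have := hM.det_pos
    simp at this
  have hcs : ∀ x y : n → ℝ, (x ⬝ᵥ y) ^ 2 ≤ (x ⬝ᵥ x) * (y ⬝ᵥ y) := by
    intro x y
    have := Finset.sum_mul_sq_le_sq_mul_sq Finset.univ x y
    simpa [dotProduct, sq] using this
  have key : ‖M‖ ≤ ‖T‖ * ‖M‖ := by
    refine norm_le_of_mulVec_dotProduct_self_le (by positivity) fun x => ?_
    set p := (M *ᵥ x) ⬝ᵥ (M *ᵥ x) with hp
    have h1 : p ≤ ‖M‖ * (x ⬝ᵥ M *ᵥ x) := mulVec_dotProduct_self_le_norm_mul hM.posSemidef x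
    have h2 := quadForm_nonneg hS x
    have h3 := mulVec_dotProduct_self_le T (M *ᵥ x)
    have h4 := hcs x (T *ᵥ (M *ᵥ x))
    rw [← hp] at h3
    have h5 : x ⬝ᵥ T *ᵥ (M *ᵥ x) = x ⬝ᵥ M *ᵥ x + x ⬝ᵥ S *ᵥ x := by rw [hTM, dotProduct_add]
    have hp0 : 0 ≤ p := dotProduct_self_nonneg' _
    have hx0 : 0 ≤ x ⬝ᵥ x := dotProduct_self_nonneg' _
    have h6 : p ≤ ‖M‖ * (x ⬝ᵥ T *ᵥ (M *ᵥ x)) := by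
      rw [h5]
      nlinarith
    have h7 : p ^ 2 ≤ ‖M‖ ^ 2 * ((x ⬝ᵥ x) * (‖T‖ ^ 2 * p)) := by
      calc p ^ 2 ≤ (‖M‖ * (x ⬝ᵥ T *ᵥ (M *ᵥ x))) ^ 2 := by gcongr
        _ = ‖M‖ ^ 2 * (x ⬝ᵥ T *ᵥ (M *ᵥ x)) ^ 2 := by ring
        _ ≤ ‖M‖ ^ 2 * ((x ⬝ᵥ x) * (‖T‖ ^ 2 * p)) := by
          gcongr
          exact h4.trans (by gcongr)
    rcases hp0.eq_or_lt with h | h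
    · rw [← h]; positivity
    · refine le_of_mul_le_mul_right ?_ h
      calc p * p = p ^ 2 := (sq p).symm
        _ ≤ _ := h7
        _ = _ := by ring
  exact le_of_mul_le_mul_right (by linarith) hM0

variable {p q : ℕ} {A : Matrix (Fin p) (Fin q) ℝ}

theorem sigmaMin_nonneg (A : Matrix (Fin p) (Fin q) ℝ) : 0 ≤ sigmaMin A :=
  Real.iInf_nonneg fun _ => norm_nonneg _

theorem sigmaMin_sq_mul_le (A : Matrix (Fin p) (Fin q) ℝ) (x : Fin q → ℝ) :
    sigmaMin A ^ 2 * (x ⬝ᵥ x) ≤ (A *ᵥ x) ⬝ᵥ (A *ᵥ x) := by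
  rw [dotProduct_self_eq_norm_sq, dotProduct_self_eq_norm_sq, ← mul_pow]
  have h0 := sigmaMin_nonneg A
  gcongr
  set y : EuclideanSpace ℝ (Fin q) := WithLp.toLp 2 x with hy
  change sigmaMin A * ‖y‖ ≤ ‖Matrix.toEuclideanLin A y‖
  by_cases h : y = 0
  · simp [h]
  have hn : 0 < ‖y‖ := norm_pos_iff.2 h
  have hmem : (‖y‖⁻¹ • y) ∈ Metric.sphere (0 : EuclideanSpace ℝ (Fin q)) 1 := by
    simp [norm_smul, hn.ne']
  have h1 : sigmaMin A ≤ ‖Matrix.toEuclideanLin A (‖y‖⁻¹ • y)‖ :=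
    ciInf_le (f := fun x : Metric.sphere (0 : EuclideanSpace ℝ (Fin q)) 1 =>
      ‖Matrix.toEuclideanLin A x‖) ⟨0, by rintro _ ⟨x, rfl⟩; exact norm_nonneg _⟩ ⟨_, hmem⟩
  rw [map_smul, norm_smul, norm_inv, norm_norm, inv_mul_eq_div, le_div_iff₀ hn] at h1
  exact h1

theorem nonempty_sphere (hq : 0 < q) :
    (Metric.sphere (0 : EuclideanSpace ℝ (Fin q)) 1).Nonempty := by
  have : Nonempty (Fin q) := ⟨⟨0, hq⟩⟩
  exact NormedSpace.sphere_nonempty.2 zero_le_one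

theorem sigmaMin_pos (hq : 0 < q) (hA : ∀ x, A *ᵥ x = 0 → x = 0) : 0 < sigmaMin A := by
  have hc : ContinuousOn (fun x => ‖Matrix.toEuclideanLin A x‖)
      (Metric.sphere (0 : EuclideanSpace ℝ (Fin q)) 1) :=
    (LinearMap.continuous_of_finiteDimensional (Matrix.toEuclideanLin A)).norm.continuousOn
  obtain ⟨x₀, hx₀, hmin⟩ := (isCompact_sphere _ _).exists_isMinOn (nonempty_sphere hq) hc
  have := (nonempty_sphere hq).to_subtype
  have hpos : 0 < ‖Matrix.toEuclideanLin A x₀‖ := by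
    rw [norm_pos_iff]
    intro h0
    have h1 : A *ᵥ x₀.ofLp = 0 := congrArg WithLp.ofLp h0
    have h2 : x₀ = 0 := by
      ext l
      simp [hA _ h1]
    simp [h2] at hx₀
  exact hpos.trans_le (le_ciInf fun x => hmin x.2)

theorem sigmaMin_le_norm (hq : 0 < q) (A : Matrix (Fin p) (Fin q) ℝ) : sigmaMin A ≤ ‖A‖ := by
  obtain ⟨x, hx⟩ := nonempty_sphere hq
  have h1 := (sigmaMin_sq_mul_le A x.ofLp).trans (mulVec_dotProduct_self_le A x.ofLp)
  have h2 : x.ofLp ⬝ᵥ x.ofLp = 1 := by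
    rw [dotProduct_self_eq_norm_sq]
    have h : ‖x‖ = 1 := by simpa using hx
    simp [h]
  rw [h2, mul_one, mul_one] at h1
  exact le_of_sq_le_sq h1 (norm_nonneg _)

theorem sigmaMin_pos_of_posDef {R : Matrix (Fin p) (Fin p) ℝ} (hp : 0 < p) (hR : R.PosDef) :
    0 < sigmaMin R :=
  sigmaMin_pos hp fun x hx => by rw [← inv_mulVec_mulVec hR x, hx, Matrix.mulVec_zero]

/-- The singular value bound says that `R⁻¹` has norm at most `r⁻¹`; the quadratic form estimate for
`R⁻¹` is then applied at `R *ᵥ x`. -/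
theorem mul_dotProduct_self_le_quadForm {R : Matrix (Fin p) (Fin p) ℝ} (hR : R.PosDef) {r : ℝ}
    (hr : 0 < r) (hrs : r ≤ sigmaMin R) (x : Fin p → ℝ) :
    r * (x ⬝ᵥ x) ≤ x ⬝ᵥ R *ᵥ x := by
  have h1 : ∀ y, (R⁻¹ *ᵥ y) ⬝ᵥ (R⁻¹ *ᵥ y) ≤ r⁻¹ ^ 2 * (y ⬝ᵥ y) := by
    intro y
    have h := sigmaMin_sq_mul_le R (R⁻¹ *ᵥ y)
    rw [mulVec_inv_mulVec hR] at h
    have h2 : r ^ 2 * ((R⁻¹ *ᵥ y) ⬝ᵥ (R⁻¹ *ᵥ y)) ≤ y ⬝ᵥ y := by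
      refine le_trans ?_ h
      have := dotProduct_self_nonneg' (R⁻¹ *ᵥ y)
      gcongr
    rw [inv_pow, inv_mul_eq_div, le_div_iff₀ (by positivity)]
    linarith
  have h2 := mulVec_dotProduct_self_le_quadForm hR.inv.posSemidef (inv_pos.2 hr) h1 (R *ᵥ x)
  rw [inv_mulVec_mulVec hR, inv_mul_eq_div, le_div_iff₀ hr, dotProduct_comm (R *ᵥ x)] at h2
  linarith

theorem inv_quadForm_le {R : Matrix (Fin p) (Fin p) ℝ} (hR : R.PosDef) {r : ℝ} (hr : 0 < r)
    (hrs : r ≤ sigmaMin R) (x : Fin p → ℝ) : x ⬝ᵥ R⁻¹ *ᵥ x ≤ (x ⬝ᵥ x) / r := by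
  have h1 := mul_dotProduct_self_le_quadForm hR hr hrs (R⁻¹ *ᵥ x)
  rw [mulVec_inv_mulVec hR, dotProduct_comm (R⁻¹ *ᵥ x) x] at h1
  have h2 := dotProduct_mul_le (R⁻¹ *ᵥ x) x (half_pos hr)
  rw [dotProduct_comm (R⁻¹ *ᵥ x) x] at h2
  have e : x ⬝ᵥ x / (4 * (r / 2)) = (x ⬝ᵥ x / r) / 2 := by
    field_simp
    ring
  linarith

end Spectral

end DistributedWLS

namespace DistributedWLS

open scoped Matrix Matrix.Norms.L2Operator

/-! ### Choice of the exponential weight -/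

section Scalar

/-- The base is less than `1`, and Bernoulli's inequality for its inverse beats the linear factor `3
+ 2 * k`. As `p → 1` the factor `(1 - p ^ 4) ^ 2` compensates for the closing gap. -/
theorem pow_mul_le_of_lt_one {p : ℝ} (hp : 0 < p) (hp1 : p < 1) (k : ℕ) :
    (4 * p ^ 2 / (1 + p) ^ 2) ^ k * (3 + 2 * k) * (3 * ((1 - p ^ 4) ^ 2 * (1 + p) ^ 2)) ≤ 64 := by
  have h4 : 0 < 1 - p ^ 4 := by
    have : p ^ 4 < 1 := pow_lt_one₀ hp.le hp1 (by norm_num)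
    linarith
  set D := (1 - p ^ 4) ^ 2 * (1 + p) ^ 2 with hD
  have hD0 : 0 < D := by positivity
  set x := 4 * p ^ 2 / (1 + p) ^ 2 with hx
  have hx0 : 0 < x := by positivity
  have h1 : 9 * D ≤ 64 := by
    have e1 : (1 - p ^ 4) ^ 2 ≤ 1 := pow_le_one₀ h4.le (by linarith [pow_pos hp 4])
    have e2 : (1 + p) ^ 2 ≤ 4 := by nlinarith
    have : D ≤ 1 * 4 := by rw [hD]; gcongr
    linarith
  have hxinv : x⁻¹ - 1 = (1 - p) * (1 + 3 * p) / (4 * p ^ 2) := by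
    rw [hx]
    field_simp
    ring
  have h2 : 6 * D ≤ 64 * (x⁻¹ - 1) := by
    rw [hxinv, ← mul_div_assoc, le_div_iff₀ (by positivity)]
    have e1 : (1 + p) ^ 3 ≤ 7 / 3 * (1 + 3 * p) := by nlinarith [mul_pos hp (sub_pos.2 hp1)]
    have e2 : p ^ 2 * (1 - p ^ 4) * (1 + p ^ 2) ≤ 1 := by
      have hq0 : 0 < p ^ 2 := by positivity
      have hq1 : p ^ 2 < 1 := pow_lt_one₀ hp.le hp1 (by norm_num)
      have a1 : p ^ 2 * (1 - p ^ 2) ≤ 1 / 4 := by nlinarith [sq_nonneg (p ^ 2 - 1 / 2)]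
      have a2 : (1 + p ^ 2) ^ 2 ≤ 4 := by nlinarith
      calc p ^ 2 * (1 - p ^ 4) * (1 + p ^ 2) = p ^ 2 * (1 - p ^ 2) * (1 + p ^ 2) ^ 2 := by ring
        _ ≤ 1 / 4 * 4 := by gcongr
        _ = 1 := by norm_num
    have hq : 0 < 1 - p := sub_pos.2 hp1
    calc 6 * D * (4 * p ^ 2) =
        24 * (1 - p) * ((p ^ 2 * (1 - p ^ 4) * (1 + p ^ 2)) * (1 + p) ^ 3) := by rw [hD]; ring
      _ ≤ 24 * (1 - p) * (1 * (7 / 3 * (1 + 3 * p))) := by gcongr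
      _ ≤ 64 * ((1 - p) * (1 + 3 * p)) := by
        have : 0 < (1 - p) * (1 + 3 * p) := by positivity
        linarith
  have h3 : 1 + k * (x⁻¹ - 1) ≤ x⁻¹ ^ k := by
    have := one_add_mul_le_pow (a := x⁻¹ - 1) (by have := inv_pos.2 hx0; linarith) k
    simpa using this
  calc x ^ k * (3 + 2 * k) * (3 * D) = x ^ k * (9 * D + k * (6 * D)) := by ring
    _ ≤ x ^ k * (64 + k * (64 * (x⁻¹ - 1))) := by gcongr
    _ = 64 * (x ^ k * (1 + k * (x⁻¹ - 1))) := by ring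
    _ ≤ 64 * (x ^ k * x⁻¹ ^ k) := by gcongr
    _ = 64 := by rw [← mul_pow, mul_inv_cancel₀ hx0.ne', one_pow, mul_one]

/-- A rate `w`, slightly larger than `ι`, that is compatible with the condition number `b / a`. -/
theorem exists_weight {a b t : ℝ} (ha : 0 < a) (hab : a < b)
    (ht : t = (√b - √a) / (√b + √a)) :
    0 < t ∧ t < 1 ∧ ∃ w h g : ℝ, 0 ≤ h ∧ w ^ 2 + 1 = 2 * (1 + h) * w ∧ 0 < g ∧
      g ≤ a - h * ((b - a) / 2) ∧ ∀ k : ℕ,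
        (w ^ 2) ^ k * ((b - a) * (3 / 4 * (3 + 2 * k))) * (1 - t) ^ 2 ≤
          64 * g ^ 2 * b * ((b - a) / (2 * b * a * t)) ^ 2 * t ^ (k + 1) := by
  have hb : 0 < b := ha.trans hab
  have hsa : 0 < √a := Real.sqrt_pos.2 ha
  have hsb : 0 < √b := Real.sqrt_pos.2 hb
  have hs : √a < √b := Real.sqrt_lt_sqrt ha.le hab
  have ht0 : 0 < t := by rw [ht]; exact div_pos (sub_pos.2 hs) (by positivity)
  have ht1 : t < 1 := by rw [ht, div_lt_one (by positivity)]; linarith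
  refine ⟨ht0, ht1, ?_⟩
  obtain ⟨p, hp0, hpt⟩ : ∃ p : ℝ, 0 < p ∧ t = p ^ 2 :=
    ⟨√t, Real.sqrt_pos.2 ht0, (Real.sq_sqrt ht0.le).symm⟩
  have hp1 : p < 1 := by
    by_contra! h
    have := one_le_pow₀ h (n := 2)
    linarith
  -- Parametrizing by `p = √t` and the mean `s` of the two roots makes all quantities rational.
  obtain ⟨s, hs0, hsa', hsb'⟩ : ∃ s : ℝ, 0 < s ∧ √a = s * (1 - p ^ 2) ∧ √b = s * (1 + p ^ 2) := by
    refine ⟨(√a + √b) / 2, by positivity, ?_, ?_⟩ <;>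
    · rw [← hpt, ht]
      field_simp
      ring
  have ea : a = s ^ 2 * (1 - p ^ 2) ^ 2 := by rw [← mul_pow, ← hsa', Real.sq_sqrt ha.le]
  have eb : b = s ^ 2 * (1 + p ^ 2) ^ 2 := by rw [← mul_pow, ← hsb', Real.sq_sqrt hb.le]
  have eba : b - a = 4 * p ^ 2 * s ^ 2 := by rw [ea, eb]; ring
  have hq1 : 0 < 1 - p := sub_pos.2 hp1
  have hq2 : 0 < 1 - p ^ 2 := by rw [← hpt]; linarith
  have hw : (0 : ℝ) < 2 * p ^ 2 / (1 + p) := by positivity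
  -- At `w = t = p ^ 2` the coercivity would be exactly zero. The factor `2 / (1 + p) > 1` restores
  -- some, while `w ^ 2` is still `t` times a number below `1`. The value of `h` is `(w ^ 2 + 1) /
  -- (2 * w) - 1`, and `g` is a simple lower bound for the remaining coercivity.
  refine ⟨2 * p ^ 2 / (1 + p), (p ^ 4 / (1 + p) + (1 + p) / 4) / p ^ 2 - 1,
    s ^ 2 * ((1 - p) / 2) * (1 - p ^ 2), ?_, ?_, by positivity, ?_, ?_⟩
  · have e : (p ^ 4 / (1 + p) + (1 + p) / 4) / p ^ 2 - 1 =
        ((2 * p ^ 2 - (1 + p)) ^ 2) / (4 * (1 + p) * p ^ 2) := by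
      field_simp
      ring
    rw [e]
    positivity
  · field_simp
    ring
  · rw [eba, ea]
    have e : s ^ 2 * (1 - p ^ 2) ^ 2 -
        ((p ^ 4 / (1 + p) + (1 + p) / 4) / p ^ 2 - 1) * (4 * p ^ 2 * s ^ 2 / 2) =
        s ^ 2 * ((1 - p) / 2) * (1 - 2 * p ^ 4 / (1 + p)) := by
      field_simp
      ring
    have h1 : 2 * p ^ 4 / (1 + p) ≤ p ^ 2 := by
      rw [div_le_iff₀ (by positivity)]
      nlinarith [mul_nonneg (sq_nonneg p) (mul_nonneg hq1.le (by linarith : 0 ≤ 1 + 2 * p))]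
    rw [e]
    gcongr
  · intro k
    have h := pow_mul_le_of_lt_one hp0 hp1 k
    have ew : (2 * p ^ 2 / (1 + p)) ^ 2 = p ^ 2 * (4 * p ^ 2 / (1 + p) ^ 2) := by
      field_simp
      norm_num
    have hq4 : 0 < 1 - p ^ 4 := by
      have : p ^ 4 < 1 := pow_lt_one₀ hp0.le hp1 (by norm_num)
      linarith
    rw [ew, mul_pow, hpt, eba]
    set x := 4 * p ^ 2 / (1 + p) ^ 2
    have er : 64 * (s ^ 2 * ((1 - p) / 2) * (1 - p ^ 2)) ^ 2 * b *
        (4 * p ^ 2 * s ^ 2 / (2 * b * a * p ^ 2)) ^ 2 * (p ^ 2) ^ (k + 1) =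
        (p ^ 2) ^ (k + 1) * s ^ 2 * (1 - p ^ 2) ^ 2 * 64 / ((1 - p ^ 4) ^ 2 * (1 + p) ^ 2) := by
      have e4 : 1 - p ^ 4 = (1 - p) * (1 + p) * (1 + p ^ 2) := by ring
      have e2 : 1 - p ^ 2 = (1 - p) * (1 + p) := by ring
      rw [ea, eb, e4, e2]
      field_simp
      ring
    rw [er, le_div_iff₀ (by positivity)]
    calc _ = (p ^ 2) ^ (k + 1) * s ^ 2 * (1 - p ^ 2) ^ 2 *
          (x ^ k * (3 + 2 * k) * (3 * ((1 - p ^ 4) ^ 2 * (1 + p) ^ 2))) := by ring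
      _ ≤ _ := by gcongr

end Scalar
end DistributedWLS

namespace DistributedWLS.Network

open scoped Matrix Matrix.Norms.L2Operator

variable {V : Type*} [Fintype V] {W : DistributedWLS.Network V}

/-! ### The constants -/

section Constants

theorem mulVec_eq_zero_of_C {V : Type*} {W : Network V} (hlocal : ∀ i, (W.selfInfo i).PosDef) (i : V) (x : Fin (W.n i) → ℝ)
    (hx : W.C i *ᵥ x = 0) : x = 0 := by
  rw [← inv_mulVec_mulVec (hlocal i) x, selfInfo, ← Matrix.mulVec_mulVec, hx,
    Matrix.mulVec_zero, Matrix.mulVec_zero]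

theorem m_pos {V : Type*} {W : Network V} (hlocal : ∀ i, (W.selfInfo i).PosDef) (i : V) : 0 < W.m i := by
  by_contra! h
  have h0 : W.m i = 0 := by omega
  have : IsEmpty (Fin (W.m i)) := by rw [h0]; infer_instance
  have h1 : (fun _ => 1 : Fin (W.n i) → ℝ) = 0 :=
    mulVec_eq_zero_of_C hlocal i _ (Subsingleton.elim _ _)
  simpa using congrFun h1 ⟨0, W.n_pos i⟩

instance finite_dart : Finite W.graph.Dart :=
  Finite.of_injective (fun d : W.graph.Dart => d.toProd) fun a b h => SimpleGraph.Dart.ext a b h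

theorem iInf_pos' {ι : Type*} [Finite ι] [Nonempty ι] {f : ι → ℝ} (h : ∀ i, 0 < f i) :
    0 < ⨅ i, f i := by
  obtain ⟨i, hi⟩ := exists_eq_ciInf_of_finite (f := f)
  rw [← hi]
  exact h i

theorem edge_nonempty (hdeg : ∃ i, 2 ≤ (W.nbrs i).card) : Nonempty W.graph.edgeSet := by
  obtain ⟨i, hi⟩ := hdeg
  obtain ⟨j, hj⟩ := Finset.card_pos.1 (by omega : 0 < (W.nbrs i).card)
  exact ⟨⟨s(i, j), (W.mem_nbrs).1 hj⟩⟩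

theorem rLower_pos (hlocal : ∀ i, (W.selfInfo i).PosDef) (hdeg : ∃ i, 2 ≤ (W.nbrs i).card) :
    0 < W.rLower := by
  have := edge_nonempty hdeg
  have : Nonempty V := ⟨hdeg.choose⟩
  exact lt_min (iInf_pos' fun i => sigmaMin_pos_of_posDef (m_pos hlocal i) (W.R_posDef i))
    (iInf_pos' fun e => sigmaMin_pos_of_posDef (W.mJ_pos e e.2) (W.RJ_posDef e e.2))

theorem rLower_le (i : V) : W.rLower ≤ sigmaMin (W.R i) :=
  (min_le_left _ _).trans (ciInf_le (Set.finite_range _).bddBelow i)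

theorem rLower_le_edge {e : Sym2 V} (he : e ∈ W.graph.edgeSet) :
    W.rLower ≤ sigmaMin (W.RJ e) :=
  (min_le_right _ _).trans
    (ciInf_le (f := fun e : W.graph.edgeSet => sigmaMin (W.RJ e)) (Set.finite_range _).bddBelow
      ⟨e, he⟩)

theorem norm_le_rUpper (i : V) : ‖W.R i‖ ≤ W.rUpper :=
  (le_ciSup (f := fun i => ‖W.R i‖) (Set.finite_range _).bddAbove i).trans (le_max_left _ _)

theorem rLower_le_rUpper (hlocal : ∀ i, (W.selfInfo i).PosDef) (i : V) : W.rLower ≤ W.rUpper :=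
  (rLower_le i).trans ((sigmaMin_le_norm (m_pos hlocal i) _).trans (norm_le_rUpper i))

theorem epsLower_le (i : V) : W.epsLower ≤ sigmaMin (W.C i) :=
  ciInf_le (Set.finite_range _).bddBelow i

theorem epsLower_pos [Nonempty V] (hlocal : ∀ i, (W.selfInfo i).PosDef) : 0 < W.epsLower :=
  iInf_pos' fun i => sigmaMin_pos (W.n_pos i) (mulVec_eq_zero_of_C hlocal i)

theorem card_nbrs_le (i : V) : ((W.nbrs i).card : ℝ) ≤ W.uBar + 1 := by
  rw [uBar, sub_add_cancel, Nat.cast_le]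
  exact Finset.le_sup (f := fun i => (W.nbrs i).card) (Finset.mem_univ i)

theorem one_le_uBar (hdeg : ∃ i, 2 ≤ (W.nbrs i).card) : 1 ≤ W.uBar := by
  obtain ⟨i, hi⟩ := hdeg
  have h1 : (2 : ℝ) ≤ (W.nbrs i).card := by exact_mod_cast hi
  linarith [W.card_nbrs_le i]

theorem sq_le_epsUpper_sq {e : Sym2 V} (he : e ∈ W.graph.edgeSet) {i : V}
    (hi : i ∈ e) : ‖W.C i‖ ^ 2 + 4 * W.uBar * ‖W.CJ e i‖ ^ 2 ≤ W.epsUpper ^ 2 := by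
  obtain ⟨j, rfl⟩ := hi
  have h := le_ciSup (f := fun d : W.graph.Dart =>
    √(‖W.C d.fst‖ ^ 2 + 4 * W.uBar * ‖W.CJ d.edge d.fst‖ ^ 2)) (Set.finite_range _).bddAbove
    (⟨(i, j), he⟩ : W.graph.Dart)
  exact Real.sqrt_le_left (Real.iSup_nonneg fun _ => Real.sqrt_nonneg _) |>.1 h

theorem epsUpper_nonneg : 0 ≤ W.epsUpper := Real.iSup_nonneg fun _ => Real.sqrt_nonneg _

theorem norm_z_le_zBar (i : V) : ‖W.z i‖ ≤ W.zBar :=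
  (le_ciSup (f := fun i => ‖W.z i‖) (Set.finite_range _).bddAbove i).trans (le_max_left _ _)

theorem norm_zJ_le_zBar {e : Sym2 V} (he : e ∈ W.graph.edgeSet) : ‖W.zJ e‖ ≤ W.zBar :=
  (le_ciSup (f := fun e : W.graph.edgeSet => ‖W.zJ e‖) (Set.finite_range _).bddAbove
    ⟨e, he⟩).trans (le_max_right _ _)

theorem m_le_mBar (i : V) : W.m i ≤ W.mBar :=
  (Finset.le_sup (f := W.m) (Finset.mem_univ i)).trans (le_max_left _ _)

theorem mJ_le_mBar {e : Sym2 V} (he : e ∈ W.graph.edgeSet) : W.mJ e ≤ W.mBar := by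
  classical
  exact (Finset.le_sup (f := W.mJ) (by simpa using he)).trans (le_max_right _ _)

theorem dotProduct_self_le_card_mul {p M : ℕ} (hp : p ≤ M) {z : Fin p → ℝ} {c : ℝ}
    (hz : ‖z‖ ≤ c) : z ⬝ᵥ z ≤ M * c ^ 2 := by
  have h : ∀ l, z l * z l ≤ c ^ 2 := by
    intro l
    have h1 := (norm_le_pi_norm z l).trans hz
    rw [← sq, ← sq_abs]
    exact pow_le_pow_left₀ (abs_nonneg _) h1 2
  calc z ⬝ᵥ z ≤ ∑ _l : Fin p, c ^ 2 := Finset.sum_le_sum fun l _ => h l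
    _ = p * c ^ 2 := by simp
    _ ≤ M * c ^ 2 := by gcongr

theorem qLower_pos (hlocal : ∀ i, (W.selfInfo i).PosDef) (hdeg : ∃ i, 2 ≤ (W.nbrs i).card) :
    0 < W.qLower := by
  have : Nonempty V := ⟨hdeg.choose⟩
  have h1 := epsLower_pos hlocal
  have h2 := (rLower_pos hlocal hdeg).trans_le (rLower_le_rUpper hlocal hdeg.choose)
  exact mul_pos (by positivity) (by positivity)

/-- This is what the term `4 ū ‖C_{i,j}‖²` in `ε̄` is for: `q̲ ≤ ‖C_i‖² / r̲`, so subtracting `q̲`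
from `q̄` leaves at least the joint part. -/
theorem four_mul_norm_sq_le (hlocal : ∀ i, (W.selfInfo i).PosDef)
    (hdeg : ∃ i, 2 ≤ (W.nbrs i).card) {e : Sym2 V} (he : e ∈ W.graph.edgeSet) {i : V}
    (hi : i ∈ e) : 4 * W.uBar * ‖W.CJ e i‖ ^ 2 / W.rLower ≤ W.qUpper - W.qLower := by
  have : Nonempty V := ⟨i⟩
  have hu := one_le_uBar hdeg
  have hr := rLower_pos hlocal hdeg
  have h1 := sq_le_epsUpper_sq he hi
  have h2 := epsLower_pos hlocal
  have h3 : W.epsLower ^ 2 ≤ ‖W.C i‖ ^ 2 := by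
    gcongr
    exact (epsLower_le i).trans (sigmaMin_le_norm (W.n_pos i) _)
  have h4 : W.qLower ≤ W.epsLower ^ 2 / W.rLower := by
    rw [qLower, ← div_eq_mul_inv]
    gcongr
    exact rLower_le_rUpper hlocal i
  have h5 : (W.epsLower ^ 2 + 4 * W.uBar * ‖W.CJ e i‖ ^ 2) / W.rLower ≤ W.qUpper := by
    rw [qUpper, ← div_eq_mul_inv]
    gcongr
    linarith
  rw [add_div] at h5
  linarith

theorem qLower_lt_qUpper (hlocal : ∀ i, (W.selfInfo i).PosDef)
    (hdeg : ∃ i, 2 ≤ (W.nbrs i).card)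
    (hjoint : ∃ i j, W.graph.Adj i j ∧ W.CJ s(i, j) i ≠ 0) : W.qLower < W.qUpper := by
  obtain ⟨i, j, hij, h0⟩ := hjoint
  have h1 := four_mul_norm_sq_le hlocal hdeg (e := s(i, j)) hij (i := i) (by simp)
  have h2 := norm_pos_iff.2 h0
  have h3 := rLower_pos hlocal hdeg
  have h4 := one_le_uBar hdeg
  have : 0 < 4 * W.uBar * ‖W.CJ s(i, j) i‖ ^ 2 / W.rLower := by positivity
  linarith

theorem bounds (hlocal : ∀ i, (W.selfInfo i).PosDef) (hdeg : ∃ i, 2 ≤ (W.nbrs i).card)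
    (hq : W.qLower ≤ W.qUpper) :
    W.Bounds W.qLower ((W.qUpper - W.qLower) / (4 * W.uBar))
      (W.mBar * W.zBar ^ 2 / W.rLower) W.uBar := by
  have : Nonempty V := ⟨hdeg.choose⟩
  have hu := one_le_uBar hdeg
  have hr := rLower_pos hlocal hdeg
  have hG : ∀ e ∈ W.graph.edgeSet, ∀ i ∈ e,
      ‖W.CJ e i‖ ^ 2 / W.rLower ≤ (W.qUpper - W.qLower) / (4 * W.uBar) := by
    intro e he i hi
    rw [le_div_iff₀ (by positivity)]
    calc _ = 4 * W.uBar * ‖W.CJ e i‖ ^ 2 / W.rLower := by ring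
      _ ≤ _ := four_mul_norm_sq_le hlocal hdeg he hi
  refine ⟨div_nonneg (by linarith) (by linarith), by linarith, fun i x => ?_, fun e he i hi x => ?_,
    fun e he i hi r => ?_, fun i => ?_, fun e he => ?_, card_nbrs_le⟩
  · have h1 := dotProduct_self_le_norm_mul_inv (W.R_posDef i) (W.C i *ᵥ x)
    have h2 := sigmaMin_sq_mul_le (W.C i) x
    have h3 := dotProduct_self_nonneg' x
    have h4 := quadForm_nonneg (W.R_posDef i).inv.posSemidef (W.C i *ᵥ x)
    have hru : 0 < W.rUpper := hr.trans_le (rLower_le_rUpper hlocal i)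
    have e1 : x ⬝ᵥ W.selfInfo i *ᵥ x = (W.C i *ᵥ x) ⬝ᵥ (W.R i)⁻¹ *ᵥ (W.C i *ᵥ x) := by
      rw [selfInfo, Matrix.mul_assoc, ← Matrix.mulVec_mulVec, transpose_mulVec_dotProduct,
        ← Matrix.mulVec_mulVec, dotProduct_comm]
    have h5 : W.epsLower ^ 2 * (x ⬝ᵥ x) ≤ sigmaMin (W.C i) ^ 2 * (x ⬝ᵥ x) := by
      have := epsLower_pos hlocal
      gcongr
      exact epsLower_le i
    have h6 := mul_le_mul_of_nonneg_right (norm_le_rUpper (W := W) i) h4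
    rw [e1, qLower, mul_assoc, mul_comm, mul_assoc, inv_mul_eq_div, div_le_iff₀ hru]
    linarith
  · have h1 := inv_quadForm_le (W.RJ_posDef e he) hr (rLower_le_edge he) (W.CJ e i *ᵥ x)
    have h3 := dotProduct_self_nonneg' x
    calc _ ≤ _ := h1
      _ ≤ ‖W.CJ e i‖ ^ 2 * (x ⬝ᵥ x) / W.rLower := by
        gcongr
        exact mulVec_dotProduct_self_le _ _
      _ = ‖W.CJ e i‖ ^ 2 / W.rLower * (x ⬝ᵥ x) := by ring
      _ ≤ _ := mul_le_mul_of_nonneg_right (hG e he i hi) ‹_›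
  · have h1 := mul_dotProduct_self_le_quadForm (W.RJ_posDef e he) hr (rLower_le_edge he) r
    have h2 := mulVec_dotProduct_self_le (W.CJ e i)ᵀ r
    have h3 : ‖(W.CJ e i)ᵀ‖ = ‖W.CJ e i‖ := by
      rw [← Matrix.conjTranspose_eq_transpose_of_trivial, Matrix.l2_opNorm_conjTranspose]
    have h4 := quadForm_nonneg (W.RJ_posDef e he).posSemidef r
    rw [h3] at h2
    calc _ ≤ _ := h2
      _ = ‖W.CJ e i‖ ^ 2 / W.rLower * (W.rLower * (r ⬝ᵥ r)) := by field_simp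
      _ ≤ ‖W.CJ e i‖ ^ 2 / W.rLower * (r ⬝ᵥ W.RJ e *ᵥ r) := by gcongr
      _ ≤ _ := mul_le_mul_of_nonneg_right (hG e he i hi) ‹_›
  · refine (inv_quadForm_le (W.R_posDef i) hr (rLower_le i) _).trans ?_
    gcongr
    exact dotProduct_self_le_card_mul (m_le_mBar i) (norm_z_le_zBar i)
  · refine (inv_quadForm_le (W.RJ_posDef e he) hr (rLower_le_edge he) _).trans ?_
    gcongr
    exact dotProduct_self_le_card_mul (mJ_le_mBar he) (norm_zJ_le_zBar he)

theorem lam_nonneg (hu : 0 ≤ W.uBar) : 0 ≤ W.lam := by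
  have h1 : 0 ≤ W.alpha₁ := mul_nonneg hu (Real.iSup_nonneg fun _ => norm_nonneg _)
  have h2 : 0 ≤ W.alpha₂ := Real.iSup_nonneg fun _ => norm_nonneg _
  have h3 : 0 ≤ W.beta₁ := Real.iInf_nonneg fun _ => sigmaMin_nonneg _
  have h4 : 0 ≤ W.beta₂ := Real.iInf_nonneg fun _ => sigmaMin_nonneg _
  unfold lam
  positivity

theorem lam_le_one (hu : 0 ≤ W.uBar) : W.lam ≤ 1 := by
  have h1 : 0 ≤ W.alpha₁ := mul_nonneg hu (Real.iSup_nonneg fun _ => norm_nonneg _)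
  have h2 : 0 ≤ W.alpha₂ := Real.iSup_nonneg fun _ => norm_nonneg _
  have h3 : 0 ≤ W.beta₁ := Real.iInf_nonneg fun _ => sigmaMin_nonneg _
  have h4 : 0 ≤ W.beta₂ := Real.iInf_nonneg fun _ => sigmaMin_nonneg _
  exact mul_le_one₀ (div_le_one_of_le₀ (by linarith) (by positivity)) (by positivity)
    (div_le_one_of_le₀ (by linarith) (by positivity))

/-- The logarithm is a quotient of nonnegative numbers because `λ ≤ 1` and `q̲ ≤ q̄`; the
conventions for division by zero cover `λ = 0` and `λ = 1`. -/
theorem two_le_zeta (hu : 0 ≤ W.uBar) (ha : 0 < W.qLower) (hq : W.qLower ≤ W.qUpper) :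
    2 ≤ W.zeta := by
  have h1 : 0 ≤ Real.log (W.qUpper / W.qLower) := Real.log_nonneg ((one_le_div ha).2 hq)
  have h2 : 0 ≤ Real.log (1 / √W.lam) := by
    rw [one_div, Real.log_inv, neg_nonneg]
    exact Real.log_nonpos (Real.sqrt_nonneg _) (Real.sqrt_le_one.2 (lam_le_one hu))
  have : 0 ≤ Real.logb (1 / √W.lam) (W.qUpper / W.qLower) := div_nonneg h1 h2
  unfold zeta
  linarith

theorem xiBar_nonneg (hlocal : ∀ i, (W.selfInfo i).PosDef) : 0 ≤ W.xiBar := by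
  refine Real.iSup_nonneg fun j => Real.log_nonneg ?_
  have : Nonempty (Fin (W.n j)) := ⟨⟨0, W.n_pos j⟩⟩
  refine one_le_norm_one_add_mul_inv (Matrix.posSemidef_sum _ fun k hk => ?_) (hlocal j)
  have h := (W.RJ_posDef s(j, k) ((W.mem_nbrs).1 hk)).inv.posSemidef.conjTranspose_mul_mul_same
    (W.CJ s(j, k) j)
  rwa [Matrix.conjTranspose_eq_transpose_of_trivial] at h

theorem psi_nonneg (hlocal : ∀ i, (W.selfInfo i).PosDef) : 0 ≤ W.psi := by
  have := xiBar_nonneg hlocal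
  have h := Real.one_le_exp (mul_nonneg this (Real.sqrt_nonneg (W.nBar * (W.uBar + 1))))
  unfold psi
  linarith

theorem zBar_nonneg {V : Type*} {W : Network V} : 0 ≤ W.zBar :=
  (Real.iSup_nonneg fun _ => norm_nonneg _).trans (le_max_left _ _)

theorem eta_nonneg (hr : 0 ≤ W.rLower) : 0 ≤ W.eta := by
  have h1 := zBar_nonneg (W := W)
  have h2 := epsUpper_nonneg (W := W)
  unfold eta
  positivity

theorem eta_sq (hu : 0 ≤ W.uBar) (hr : 0 < W.rLower) :
    W.eta ^ 2 = 8 * (W.uBar + 1) * W.qUpper * (W.mBar * W.zBar ^ 2 / W.rLower) := by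
  unfold eta qUpper
  rw [div_pow, mul_pow, Real.sq_sqrt (by positivity)]
  field_simp

/-- Since `ι ≤ 1` and `1 / ζ ≤ 1 / 2`, the exponent in `κ` is the weaker one. -/
theorem sqrt_mul_iota_le_kappa (hu : 0 ≤ W.uBar) (hz : 2 ≤ W.zeta) (ht : 0 < W.iota)
    (ht1 : W.iota ≤ 1) : √(W.uBar * W.iota) ≤ W.kappa := by
  refine le_trans ?_ (le_max_right _ _)
  rw [Real.sqrt_mul hu, Real.sqrt_eq_rpow W.iota]
  gcongr ?_ * ?_
  apply Real.rpow_le_rpow_of_exponent_ge ht ht1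
  gcongr

theorem two_mul_eta_mul_le_chi (hlocal : ∀ i, (W.selfInfo i).PosDef) (hu : 0 ≤ W.uBar)
    (hr : 0 ≤ W.rLower) (hq : W.qLower ≤ W.qUpper) :
    2 * W.eta * W.cConst / (1 - W.iota) ≤ W.chi := by
  have h1 := psi_nonneg hlocal
  have h2 := eta_nonneg hr
  have h3 := lam_nonneg hu
  have h4 : 0 ≤ W.psi * W.eta / ((W.qUpper - W.qLower) * W.lam) :=
    div_nonneg (by positivity) (mul_nonneg (by linarith) h3)
  unfold chi
  linarith

end Constants

theorem norm_estimate_sub_le (hlocal : ∀ i, (W.selfInfo i).PosDef)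
    (hdeg : ∃ i, 2 ≤ (W.nbrs i).card)
    (hjoint : ∃ i j, W.graph.Adj i j ∧ W.CJ s(i, j) i ≠ 0) (k : ℕ) (i : V) :
    ‖W.estimate (k + 2) i - W.estimate (k + 1) i‖ ≤ W.chi * W.kappa ^ (k + 1) := by
  have hu := one_le_uBar hdeg
  have hu0 : 0 ≤ W.uBar := by linarith
  have hr := rLower_pos hlocal hdeg
  have ha := qLower_pos hlocal hdeg
  have hab := qLower_lt_qUpper hlocal hdeg hjoint
  have B := bounds hlocal hdeg hab.le
  obtain ⟨ht0, ht1, w, h, g, hh, hw, hg, hga, hk⟩ := exists_weight ha hab (t := W.iota) rfl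
  have hba : 0 < W.qUpper - W.qLower := sub_pos.2 hab
  -- As `1 ≤ ū`, one has `ū + 1 ≤ 2 ū`; this yields the `(b - a) / 2` required by `exists_weight`.
  have hG : (W.uBar + 1) * ((W.qUpper - W.qLower) / (4 * W.uBar)) ≤
      (W.qUpper - W.qLower) / 2 := by
    rw [← mul_div_assoc, div_le_div_iff₀ (by positivity) (by norm_num)]
    nlinarith
  have hga' : g ≤ W.qLower -
      h * (W.uBar + 1) * ((W.qUpper - W.qLower) / (4 * W.uBar)) := by
    have := mul_le_mul_of_nonneg_left hG hh
    linarith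
  have h1 := B.estimate_sub_le hlocal hh hw hg hga' k i
  have hb := B.meas_nonneg i
  have hη := eta_sq hu0 hr
  set β := W.mBar * W.zBar ^ 2 / W.rLower with hβ
  have hc : W.cConst = (W.qUpper - W.qLower) / (2 * W.qUpper * W.qLower * W.iota) := rfl
  have hc0 : 0 ≤ W.cConst := by
    have := ha.trans hab
    rw [hc]
    positivity
  have h2 : 1 + (W.uBar + 1) * branchCard W.uBar k ≤ (3 + 2 * k) * W.uBar ^ (k + 1) := by
    have e1 := branchCard_le hu k
    have e2 : 1 ≤ W.uBar ^ (k + 1) := one_le_pow₀ hu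
    have e3 : (W.uBar + 1) * branchCard W.uBar k ≤ 2 * W.uBar * ((k + 1) * W.uBar ^ k) := by
      have := branchCard_pos hu0 k
      gcongr
      linarith
    calc _ ≤ W.uBar ^ (k + 1) + 2 * W.uBar * ((k + 1) * W.uBar ^ k) := add_le_add e2 e3
      _ = _ := by ring
  set X := ‖W.estimate (k + 2) i - W.estimate (k + 1) i‖ with hX
  have h3 : X * (1 - W.iota) ≤
      2 * W.eta * W.cConst * √(W.uBar * W.iota) ^ (k + 1) := by
    have hη0 := eta_nonneg hr.le
    refine le_of_sq_le_sq ?_ (by positivity)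
    have hsq : (√(W.uBar * W.iota) ^ (k + 1)) ^ 2 = W.uBar ^ (k + 1) * W.iota ^ (k + 1) := by
      rw [← pow_mul, mul_comm (k + 1), pow_mul, Real.sq_sqrt (by positivity), mul_pow]
    rw [mul_pow, mul_pow _ (√(W.uBar * W.iota) ^ (k + 1)), mul_pow, mul_pow, hη, hsq]
    have hg2 : 0 < g ^ 2 := by positivity
    refine le_of_mul_le_mul_left ?_ hg2
    calc g ^ 2 * (X ^ 2 * (1 - W.iota) ^ 2) = g ^ 2 * X ^ 2 * (1 - W.iota) ^ 2 := by ring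
      _ ≤ (w ^ 2) ^ k * ((W.uBar + 1) * ((W.qUpper - W.qLower) / (4 * W.uBar)) *
          (3 / 2 * β * (1 + (W.uBar + 1) * branchCard W.uBar k))) * (1 - W.iota) ^ 2 := by
        gcongr
      _ ≤ (w ^ 2) ^ k * ((W.qUpper - W.qLower) / 2 *
          (3 / 2 * β * ((3 + 2 * k) * W.uBar ^ (k + 1)))) * (1 - W.iota) ^ 2 := by
        have := branchCard_pos hu0 k
        gcongr
      _ = β * W.uBar ^ (k + 1) * ((w ^ 2) ^ k * ((W.qUpper - W.qLower) *
          (3 / 4 * (3 + 2 * k))) * (1 - W.iota) ^ 2) := by ring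
      _ ≤ β * W.uBar ^ (k + 1) * (64 * g ^ 2 * W.qUpper * W.cConst ^ 2 * W.iota ^ (k + 1)) := by
        exact mul_le_mul_of_nonneg_left (hk k) (by positivity)
      _ = 2 * (32 * g ^ 2 * β * W.qUpper * W.uBar ^ (k + 1) * W.cConst ^ 2 *
          W.iota ^ (k + 1)) := by ring
      -- The inequality `2 ≤ ū + 1` brings in the factor `ū + 1` contained in `η ^ 2`.
      _ ≤ (W.uBar + 1) * (32 * g ^ 2 * β * W.qUpper * W.uBar ^ (k + 1) * W.cConst ^ 2 *
          W.iota ^ (k + 1)) := by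
        have := ha.trans hab
        gcongr
        linarith
      _ = _ := by ring
  have hz := two_le_zeta hu0 ha hab.le
  have hκ := sqrt_mul_iota_le_kappa hu0 hz ht0 ht1.le
  have hχ := two_mul_eta_mul_le_chi hlocal hu0 hr.le hab.le
  have ht : 0 < 1 - W.iota := sub_pos.2 ht1
  have h0 : 0 ≤ 2 * W.eta * W.cConst / (1 - W.iota) := by
    have hη0 := eta_nonneg hr.le
    positivity
  calc X ≤ 2 * W.eta * W.cConst / (1 - W.iota) * √(W.uBar * W.iota) ^ (k + 1) := by
        rw [div_mul_eq_mul_div, le_div_iff₀ ht]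
        exact h3
    _ ≤ W.chi * W.kappa ^ (k + 1) := by
        have := h0.trans hχ
        gcongr

end DistributedWLS.Network

/-! ### From geometric increments to convergence -/

theorem exists_limit_of_norm_sub_le_geometric {E : Type*} [NormedAddCommGroup E] [CompleteSpace E]
    {x : ℕ → E} {C κ : ℝ} (hκ : κ < 1)
    (h : ∀ N : ℕ, 1 ≤ N → ‖x (N + 1) - x N‖ ≤ C * κ ^ N) :
    ∃ y, Filter.Tendsto x Filter.atTop (nhds y) ∧
      ∀ N : ℕ, 1 ≤ N → ‖x N - y‖ ≤ C / (1 - κ) * κ ^ N := by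
  -- The sequence is shifted by one because nothing is assumed about `x 0`; the lost power of `κ`
  -- moves into the constant.
  have h1 : ∀ n : ℕ, dist (x (n + 1)) (x (n + 1 + 1)) ≤ C * κ * κ ^ n := by
    intro n
    rw [dist_comm, dist_eq_norm, mul_assoc, ← pow_succ']
    exact h (n + 1) (by omega)
  obtain ⟨y, hy⟩ := cauchySeq_tendsto_of_complete
    (cauchySeq_of_le_geometric κ (C * κ) hκ (f := fun n => x (n + 1)) h1)
  refine ⟨y, (Filter.tendsto_add_atTop_iff_nat 1).1 hy, fun N hN => ?_⟩
  obtain ⟨n, rfl⟩ : ∃ n, N = n + 1 := ⟨N - 1, by omega⟩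
  have h2 := dist_le_of_le_geometric_of_tendsto κ (C * κ) hκ h1 hy n
  rw [dist_eq_norm] at h2
  calc _ ≤ _ := h2
    _ = _ := by ring

theorem mainTheorem3 {V : Type*} [Fintype V] (W : DistributedWLS.Network V)
    (hlocal : ∀ i, (W.selfInfo i).PosDef)
    (hdeg : ∃ i, 2 ≤ (W.nbrs i).card)
    (hjoint : ∃ i j, W.graph.Adj i j ∧ W.CJ s(i, j) i ≠ 0)
    (hkappa : W.kappa < 1) (v₁ : V) :
    (∀ N : ℕ, 1 ≤ N →
      ‖W.estimate (N + 1) v₁ - W.estimate N v₁‖ ≤ W.chi * W.kappa ^ N) ∧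
    ∃ xInf : EuclideanSpace ℝ (Fin (W.n v₁)),
      Filter.Tendsto (fun N : ℕ => W.estimate N v₁) Filter.atTop (nhds xInf) ∧
      ∀ N : ℕ, 1 ≤ N →
        ‖W.estimate N v₁ - xInf‖ ≤ W.chi / (1 - W.kappa) * W.kappa ^ N := by
  have h : ∀ N : ℕ, 1 ≤ N →
      ‖W.estimate (N + 1) v₁ - W.estimate N v₁‖ ≤ W.chi * W.kappa ^ N := by
    intro N hN
    obtain ⟨k, rfl⟩ : ∃ k, N = k + 1 := ⟨N - 1, by omega⟩
    exact DistributedWLS.Network.norm_estimate_sub_le hlocal hdeg hjoint k v₁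
  exact ⟨h, exists_limit_of_norm_sub_le_geometric hkappa h⟩
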